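/- Let $A\cong\mathbf{C}^n$ be a complex $n$-dimensional affine space with a flat Hermitian metric, and let $T^*A\cong A\times\mathbf{C}^n$ carry the flat metric $\|z\|^2+\|w\|^2$, where $(z,w)$ denotes the covector $\sum_j w_j\,dz_j$ at $z$, and the Kähler form $\omega_1(u,v)=(iu,v)$. Let $G$ be a Lie group, with Lie algebra $\mathfrak g$, acting smoothly on $A$ by unitary affine isometries, and let it act on $T^*A$ by the natural cotangent lift. Let $\mu=(\mu_1,\mu_2,\mu_3):T^*A\to\mathfrak g^*\otimes\mathbf{R}^3$ be the hyperkähler moment map, where $\mu^c=\mu_2+i\mu_3$ is the natural one, $\mu^c_\xi(\theta_x)=\theta_x(Y_x)$ with $Y$ the vector field on $A$ generated by $\xi\in\mathfrak g$, and $\mu_1$ is any equivariant moment map for $\omega_1$. Suppose that $\mu^{-1}(0)$ is an embedded smooth submanifold of $T^*A$ and that the hyperkähler quotient $\bar M=\mu^{-1}(0)/G$, with the quotient topology, is a smooth manifold for which the projection $\mu^{-1}(0)\to\bar M$ is a submersion. Give $\bar M$ the quotient metric: the inner product on $T_{\bar x}\bar M$ is the one induced on the horizontal space in $T_x\mu^{-1}(0)$,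 the orthogonal complement of the tangent space of the $G$-orbit of $x$ (this does not depend on the choice of $x$ over $\bar x$). Let $H$ be a Lie group acting smoothly on $T^*A$ by isometries, such that $H$ preserves $\mu^{-1}(0)$ and normalizes (the group of isometries of $T^*A$ defined by) $G$. Then the action of $H$ on $\mu^{-1}(0)$ descends to a smooth action of $H$ on $\bar M$ which preserves the quotient metric, and the Killing vector fields on $\bar M$ that it generates have linear growth: for every $\xi$ in the Lie algebra of $H$, with corresponding vector field $\bar Y$ on $\bar M$, and every $\bar x_0\in\bar M$ there are constants $c',c''\ge 0$ such that $$\|\bar Y_{\bar x}\|\le c'\rho(\bar x_0,\bar x)+c''\qquad\text{for all }\bar x\in\bar M,$$ where $\rho$ is the Riemannian distance of the quotient metric (infinite between points of different components). -/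

import Mathlib

open scoped Manifold ContDiff Bundle NNReal ENNReal

noncomputable section

/-! ### Actions, isometries and growth on manifolds -/

/-- The vector field on `M` generated by `ξ ∈ Lie(K)` for an action `a` of a Lie group `K` on `M`:
at `x` it is the derivative at the identity, in the direction `ξ`, of the orbit map `k ↦ a k x`. -/
def fundamentalField {EK : Type*} [NormedAddCommGroup EK] [NormedSpace ℝ EK]
    {K : Type*} [TopologicalSpace K] [ChartedSpace EK K] [Group K]
    {E : Type*} [NormedAddCommGroup E] [NormedSpace ℝ E]
    {M : Type*} [TopologicalSpace M] [ChartedSpace E M]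
    (a : K → M → M) (ξ : GroupLieAlgebra 𝓘(ℝ, EK) K) (x : M) : TangentSpace 𝓘(ℝ, E) x :=
  (mfderiv 𝓘(ℝ, EK) 𝓘(ℝ, E) (fun k : K => a k x) 1 : EK →L[ℝ] E) ξ

/-- The adjoint action of `g` on the Lie algebra: the derivative at `1` of `h ↦ g h g⁻¹`. -/
def lieAd {EG : Type*} [NormedAddCommGroup EG] [NormedSpace ℝ EG]
    {G : Type*} [TopologicalSpace G] [ChartedSpace EG G] [Group G]
    (g : G) (ξ : GroupLieAlgebra 𝓘(ℝ, EG) G) : GroupLieAlgebra 𝓘(ℝ, EG) G :=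
  (mfderiv 𝓘(ℝ, EG) 𝓘(ℝ, EG) (fun h : G => g * h * g⁻¹) 1 : EG →L[ℝ] EG) ξ

/-- `f` preserves the Riemannian metric `g`. -/
def PreservesMetric {E : Type*} [NormedAddCommGroup E] [NormedSpace ℝ E]
    {M : Type*} [TopologicalSpace M] [ChartedSpace E M]
    (g : Bundle.RiemannianMetric (fun x : M => TangentSpace 𝓘(ℝ, E) x)) (f : M → M) : Prop :=
  ∀ (x : M) (v w : TangentSpace 𝓘(ℝ, E) x),
    g.inner (f x) (mfderiv 𝓘(ℝ, E) 𝓘(ℝ, E) f x v) (mfderiv 𝓘(ℝ, E) 𝓘(ℝ, E) f x w) =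
      g.inner x v w

/-- Linear growth of a vector field `X` with respect to the Riemannian metric `g`:
`‖X(x)‖ ≤ c' ρ(x₀, x) + c''`, with `ρ` the Riemannian distance of `g` (infinite between different
components), for every base point `x₀`. -/
def HasLinearGrowth {E : Type*} [NormedAddCommGroup E] [NormedSpace ℝ E]
    {M : Type*} [TopologicalSpace M] [ChartedSpace E M]
    (g : Bundle.RiemannianMetric (fun x : M => TangentSpace 𝓘(ℝ, E) x))
    (X : ∀ x : M, TangentSpace 𝓘(ℝ, E) x) : Prop :=
  letI : Bundle.RiemannianBundle (fun x : M => TangentSpace 𝓘(ℝ, E) x) := ⟨g⟩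
  ∀ x₀ : M, ∃ c' c'' : ℝ≥0, ∀ x : M,
    ‖X x‖ₑ ≤ c' * Manifold.riemannianEDist 𝓘(ℝ, E) x₀ x + c''

namespace HKQ

/-! ### The flat cotangent bundle -/

/-- The complex affine space `A` of dimension `n` with its flat Hermitian metric (an origin is
chosen, but the groups below act by affine, not necessarily linear, maps). -/
abbrev Aff (n : ℕ) : Type := EuclideanSpace ℂ (Fin n)

/-- `T*A ≅ A × ℂⁿ` with the flat metric `‖z‖² + ‖w‖²`; the pair `(z, w)` is the covector
`∑ wⱼ dzⱼ` at the point `z`. -/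
abbrev Cot (n : ℕ) : Type := WithLp 2 (Aff n × Aff n)

/-- The covector `w` as a linear form, `v ↦ ∑ wⱼ vⱼ`. -/
def pairing {n : ℕ} (w : Aff n) : Aff n →ₗ[ℂ] ℂ where
  toFun v := ∑ j, w j * v j
  map_add' u v := by simp [mul_add, Finset.sum_add_distrib]
  map_smul' c v := by simp [Finset.mul_sum, mul_left_comm]

/-- Coordinatewise complex conjugation. -/
def conjVec {n : ℕ} (w : Aff n) : Aff n := WithLp.toLp 2 fun j => starRingEnd ℂ (w j)

/-- The flat Riemannian metric of `T*A`. -/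
def flatInner {n : ℕ} (u v : Cot n) : ℝ := (inner ℂ u v).re

/-- The Kähler form `ω₁(u, v) = (I u, v)` of the complex structure `I` (multiplication by `i`). -/
def omegaOne {n : ℕ} (u v : Cot n) : ℝ := flatInner (Complex.I • u) v

/-- The natural lift of a unitary affine map `g` of `A` to `T*A`: `(z, w) ↦ (g z, w ∘ (dg)⁻¹)`.
As the linear part `U` of `g` is unitary, the covector `w ∘ U⁻¹` has coordinates
`conj (U (conj w))`. -/
def liftFun {n : ℕ} (g : Aff n ≃ᵃⁱ[ℂ] Aff n) (p : Cot n) : Cot n :=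
  WithLp.toLp 2 (g p.fst, conjVec (g.linearIsometryEquiv (conjVec p.snd)))

lemma conjVec_conjVec {n : ℕ} (w : Aff n) : conjVec (conjVec w) = w := by
  ext j; simp [conjVec]

lemma conjVec_sub {n : ℕ} (v w : Aff n) : conjVec v - conjVec w = conjVec (v - w) := by
  ext j; simp [conjVec]

lemma norm_conjVec {n : ℕ} (w : Aff n) : ‖conjVec w‖ = ‖w‖ := by
  simp [conjVec, EuclideanSpace.norm_eq]

lemma pairing_lift {n : ℕ} (g : Aff n ≃ᵃⁱ[ℂ] Aff n) (w v : Aff n) :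
    pairing (conjVec (g.linearIsometryEquiv (conjVec w))) (g.linearIsometryEquiv v) =
      pairing w v := by
  have key : ∀ a b : Aff n, pairing (conjVec a) b = inner ℂ a b := by
    intro a b
    simp [pairing, conjVec, PiLp.inner_apply, mul_comm]
  rw [key, LinearIsometryEquiv.inner_map_map, ← key, conjVec_conjVec]

lemma isometry_liftFun {n : ℕ} (g : Aff n ≃ᵃⁱ[ℂ] Aff n) : Isometry (liftFun g) := by
  refine Isometry.of_dist_eq fun p q => ?_
  rw [WithLp.prod_dist_eq_of_L2, WithLp.prod_dist_eq_of_L2]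
  congr 3
  · simp [liftFun]
  · simp only [liftFun, WithLp.toLp_snd]
    rw [dist_eq_norm, conjVec_sub, norm_conjVec, ← map_sub, LinearIsometryEquiv.norm_map,
      conjVec_sub, norm_conjVec, dist_eq_norm]

lemma liftFun_mul {n : ℕ} (g h : Aff n ≃ᵃⁱ[ℂ] Aff n) (p : Cot n) :
    liftFun (g * h) p = liftFun g (liftFun h p) := by
  have h1 : liftFun g (liftFun h p) = WithLp.toLp 2 (g (h p.fst), conjVec
      (g.linearIsometryEquiv (conjVec (conjVec (h.linearIsometryEquiv (conjVec p.snd)))))) := rfl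
  rw [h1, conjVec_conjVec]
  rfl

lemma liftFun_one {n : ℕ} (p : Cot n) : liftFun 1 p = p := by
  have : liftFun 1 p = WithLp.toLp 2 (p.fst, conjVec (conjVec p.snd)) := rfl
  rw [this, conjVec_conjVec]
  rfl

/-- The cotangent lift as an action of the unitary affine group on `T*A` by isometries. -/
def cotLift {n : ℕ} : (Aff n ≃ᵃⁱ[ℂ] Aff n) →* (Cot n ≃ᵢ Cot n) where
  toFun g :=
    { toFun := liftFun g
      invFun := liftFun g⁻¹
      left_inv := fun p => by rw [← liftFun_mul, inv_mul_cancel, liftFun_one]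
      right_inv := fun p => by rw [← liftFun_mul, mul_inv_cancel, liftFun_one]
      isometry_toFun := isometry_liftFun g }
  map_one' := by ext1 p; exact liftFun_one p
  map_mul' g h := by ext1 p; exact liftFun_mul g h p

/-! ### Moment maps and the quotient -/

section Moment

variable {n : ℕ} {EG : Type*} [NormedAddCommGroup EG] [NormedSpace ℝ EG]
  {G : Type*} [TopologicalSpace G] [ChartedSpace EG G] [Group G]

/-- The natural complex moment map of the lifted action, `μᶜ_ξ(θ_x) = θ_x(Y_x)`, where `Y` is the
vector field on `A` generated by `ξ`. -/
def complexMoment (ρ : G →* (Aff n ≃ᵃⁱ[ℂ] Aff n)) (p : Cot n) :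
    GroupLieAlgebra 𝓘(ℝ, EG) G →ₗ[ℝ] ℂ where
  toFun ξ := pairing p.snd (fundamentalField (E := Aff n) (fun g x => ρ g x) ξ p.fst)
  map_add' ξ η := by
    refine Eq.trans (congrArg _ (map_add (mfderiv 𝓘(ℝ, EG) 𝓘(ℝ, Aff n)
      (fun g : G => ρ g p.fst) 1) ξ η)) (map_add (pairing p.snd) _ _)
  map_smul' c ξ := by
    refine Eq.trans (congrArg _ (map_smul (mfderiv 𝓘(ℝ, EG) 𝓘(ℝ, Aff n)
      (fun g : G => ρ g p.fst) 1) c ξ)) (((pairing p.snd).restrictScalars ℝ).map_smul c _)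

/-- `μ₁ : T*A → 𝔤*` is a moment map for the Kähler form `ω₁` and the lifted action of `G`:
`d⟨μ₁, ξ⟩ = ι(X_ξ) ω₁` for all `ξ ∈ 𝔤`, and `μ₁` is equivariant for the coadjoint action. -/
structure IsMomentMapOne (ρ : G →* (Aff n ≃ᵃⁱ[ℂ] Aff n))
    (μ₁ : Cot n → Module.Dual ℝ (GroupLieAlgebra 𝓘(ℝ, EG) G)) : Prop where
  contDiff : ∀ ξ, ContDiff ℝ ∞ fun p => μ₁ p ξ
  fderiv_eq : ∀ ξ p v, fderiv ℝ (fun p => μ₁ p ξ) p v =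
    omegaOne (fundamentalField (E := Cot n) (fun g x => cotLift (ρ g) x) ξ p) v
  equivariant : ∀ g p ξ, μ₁ (cotLift (ρ g) p) ξ = μ₁ p (lieAd g⁻¹ ξ)

/-- The hyperkähler moment map `μ = (μ₁, μ₂, μ₃) : T*A → 𝔤* ⊗ ℝ³`, with `μᶜ = μ₂ + i μ₃`. -/
def moment (ρ : G →* (Aff n ≃ᵃⁱ[ℂ] Aff n))
    (μ₁ : Cot n → Module.Dual ℝ (GroupLieAlgebra 𝓘(ℝ, EG) G)) (p : Cot n) :
    Fin 3 → Module.Dual ℝ (GroupLieAlgebra 𝓘(ℝ, EG) G) :=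
  ![μ₁ p, Complex.reLm ∘ₗ complexMoment ρ p, Complex.imLm ∘ₗ complexMoment ρ p]

/-- The level set `μ⁻¹(0)`. -/
def zeroLevel (ρ : G →* (Aff n ≃ᵃⁱ[ℂ] Aff n))
    (μ₁ : Cot n → Module.Dual ℝ (GroupLieAlgebra 𝓘(ℝ, EG) G)) : Set (Cot n) :=
  {p | moment ρ μ₁ p = 0}

/-- Two points of `μ⁻¹(0)` are equivalent if they lie on the same `G`-orbit. -/
def orbitSetoid (ρ : G →* (Aff n ≃ᵃⁱ[ℂ] Aff n))
    (μ₁ : Cot n → Module.Dual ℝ (GroupLieAlgebra 𝓘(ℝ, EG) G)) : Setoid (zeroLevel ρ μ₁) where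
  r p q := ∃ g : G, cotLift (ρ g) p.1 = q.1
  iseqv :=
    { refl := fun p => ⟨1, by simp⟩
      symm := by
        rintro p q ⟨g, hg⟩
        refine ⟨g⁻¹, ?_⟩
        rw [← hg, ← IsometryEquiv.mul_apply, ← map_mul, ← map_mul]
        simp
      trans := by
        rintro p q r ⟨g, hg⟩ ⟨h, hh⟩
        refine ⟨h * g, ?_⟩
        rw [map_mul, map_mul, IsometryEquiv.mul_apply, hg, hh] }

/-- The hyperkähler quotient `μ⁻¹(0)/G`, with the quotient topology. -/
abbrev HKQuotient (ρ : G →* (Aff n ≃ᵃⁱ[ℂ] Aff n))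
    (μ₁ : Cot n → Module.Dual ℝ (GroupLieAlgebra 𝓘(ℝ, EG) G)) : Type :=
  Quotient (orbitSetoid ρ μ₁)

/-- The projection `μ⁻¹(0) → μ⁻¹(0)/G`. -/
def proj (ρ : G →* (Aff n ≃ᵃⁱ[ℂ] Aff n))
    (μ₁ : Cot n → Module.Dual ℝ (GroupLieAlgebra 𝓘(ℝ, EG) G)) (x : zeroLevel ρ μ₁) :
    HKQuotient ρ μ₁ :=
  Quotient.mk (orbitSetoid ρ μ₁) x

end Moment

/-! ### The quotient metric -/

section Calculus

open Manifold

variable {E E' : Type*} [NormedAddCommGroup E] [NormedSpace ℝ E]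
  [NormedAddCommGroup E'] [NormedSpace ℝ E']
  {M N : Type*} [TopologicalSpace M] [ChartedSpace E M]
  [TopologicalSpace N] [ChartedSpace E' N] {f : M → N}

lemma mdifferentiableAt_extend {φ : OpenPartialHomeomorph M E}
    (hφ : φ ∈ IsManifold.maximalAtlas 𝓘(ℝ, E) ∞ M) {x : M} (hx : x ∈ φ.source) :
    MDifferentiableAt 𝓘(ℝ, E) 𝓘(ℝ, E) (φ.extend 𝓘(ℝ, E)) x :=
  ((contMDiffOn_of_mem_maximalAtlas hφ).contMDiffAt
    (φ.open_source.mem_nhds hx)).mdifferentiableAt (by simp)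

lemma mdifferentiableAt_extend_symm {φ : OpenPartialHomeomorph M E}
    (hφ : φ ∈ IsManifold.maximalAtlas 𝓘(ℝ, E) ∞ M) {y : E} (hy : y ∈ φ.target) :
    MDifferentiableAt 𝓘(ℝ, E) 𝓘(ℝ, E) (φ.extend 𝓘(ℝ, E)).symm y :=
  ((contMDiffOn_symm_of_mem_maximalAtlas hφ).contMDiffAt
    (φ.open_target.mem_nhds hy)).mdifferentiableAt (by simp)

lemma mfderiv_injective_of_leftInverse {x : M} {r : N → M}
    (hf : MDifferentiableAt 𝓘(ℝ, E) 𝓘(ℝ, E') f x)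
    (hr : MDifferentiableAt 𝓘(ℝ, E') 𝓘(ℝ, E) r (f x)) (h : ∀ᶠ y in nhds x, r (f y) = y) :
    Function.Injective (mfderiv 𝓘(ℝ, E) 𝓘(ℝ, E') f x) := by
  have h1 : HasMFDerivAt 𝓘(ℝ, E) 𝓘(ℝ, E) (r ∘ f) x
      ((mfderiv 𝓘(ℝ, E') 𝓘(ℝ, E) r (f x)).comp (mfderiv 𝓘(ℝ, E) 𝓘(ℝ, E') f x)) :=
    hr.hasMFDerivAt.comp x hf.hasMFDerivAt
  have h2 : HasMFDerivAt 𝓘(ℝ, E) 𝓘(ℝ, E) (r ∘ f) x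
      (ContinuousLinearMap.id ℝ (TangentSpace 𝓘(ℝ, E) x)) :=
    (hasMFDerivAt_id x).congr_of_eventuallyEq h
  have h3 := hasMFDerivAt_unique h1 h2
  intro v w hvw
  have key : ∀ u : E, (mfderiv 𝓘(ℝ, E') 𝓘(ℝ, E) r (f x))
      (mfderiv 𝓘(ℝ, E) 𝓘(ℝ, E') f x u) = u := fun u => DFunLike.congr_fun h3 u
  have := key v
  rw [show mfderiv 𝓘(ℝ, E) 𝓘(ℝ, E') f x v = mfderiv 𝓘(ℝ, E) 𝓘(ℝ, E') f x w from hvw] at this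
  exact this.symm.trans (key w)

lemma mfderiv_surjective_of_rightInverse {x : M} {s : N → M} (hs' : s (f x) = x)
    (hf : MDifferentiableAt 𝓘(ℝ, E) 𝓘(ℝ, E') f x)
    (hs : MDifferentiableAt 𝓘(ℝ, E') 𝓘(ℝ, E) s (f x)) (h : ∀ᶠ y in nhds (f x), f (s y) = y) :
    Function.Surjective (mfderiv 𝓘(ℝ, E) 𝓘(ℝ, E') f x) := by
  have h1 : HasMFDerivAt 𝓘(ℝ, E') 𝓘(ℝ, E') (f ∘ s) (f x)
      ((mfderiv 𝓘(ℝ, E) 𝓘(ℝ, E') f (s (f x))).comp (mfderiv 𝓘(ℝ, E') 𝓘(ℝ, E) s (f x))) :=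
    HasMFDerivAt.comp (f x) (by rw [hs']; exact hf.hasMFDerivAt) hs.hasMFDerivAt
  have h2 : HasMFDerivAt 𝓘(ℝ, E') 𝓘(ℝ, E') (f ∘ s) (f x)
      (ContinuousLinearMap.id ℝ (TangentSpace 𝓘(ℝ, E') (f x))) :=
    (hasMFDerivAt_id (f x)).congr_of_eventuallyEq h
  have h3 := hasMFDerivAt_unique h1 h2
  rw [hs'] at h3
  intro v
  exact ⟨_, DFunLike.congr_fun h3 v⟩

lemma mfderiv_injective_of_isImmersionAt {x : M} (h : IsImmersionAt 𝓘(ℝ, E) 𝓘(ℝ, E') ∞ f x) :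
    Function.Injective (mfderiv 𝓘(ℝ, E) 𝓘(ℝ, E') f x) := by
  have hd : MDifferentiableAt 𝓘(ℝ, E) 𝓘(ℝ, E') f x := h.contMDiffAt.mdifferentiableAt (by simp)
  obtain ⟨F, _, _, h⟩ := h
  have hw : ∀ y ∈ h.domChart.target, h.codChart (f (h.domChart.symm y)) = h.equiv (y, 0) := by
    intro y hy
    have h0 : y ∈ (h.domChart.extend 𝓘(ℝ, E)).target := by simpa using hy
    exact h.writtenInCharts h0
  set φ := h.domChart
  set ψ := h.codChart
  refine mfderiv_injective_of_leftInverse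
    (r := (φ.extend 𝓘(ℝ, E)).symm ∘ (fun y : E' => (h.equiv.symm y).1) ∘ ψ.extend 𝓘(ℝ, E')) hd ?_ ?_
  · have hval : (h.equiv.symm (ψ (f x))).1 = φ x := by
      have := hw _ (φ.map_source h.mem_domChart_source)
      rw [φ.left_inv h.mem_domChart_source] at this
      rw [this]; simp
    refine MDifferentiableAt.comp (I' := 𝓘(ℝ, E)) _ ?_ (MDifferentiableAt.comp (I' := 𝓘(ℝ, E')) _ ?_ ?_)
    · refine mdifferentiableAt_extend_symm h.domChart_mem_maximalAtlas ?_
      change (h.equiv.symm (ψ (f x))).1 ∈ _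
      rw [hval]
      exact φ.map_source h.mem_domChart_source
    · exact (by fun_prop : DifferentiableAt ℝ (fun y : E' => (h.equiv.symm y).1) _).mdifferentiableAt
    · exact mdifferentiableAt_extend h.codChart_mem_maximalAtlas h.mem_codChart_source
  · filter_upwards [φ.open_source.mem_nhds h.mem_domChart_source] with y hy
    have := hw _ (φ.map_source hy)
    rw [φ.left_inv hy] at this
    change φ.symm (h.equiv.symm (ψ (f y))).1 = y
    rw [this]
    simpa using φ.left_inv hy

lemma mfderiv_surjective_of_isSubmersionAt {x : M} (h : IsSubmersionAt 𝓘(ℝ, E) 𝓘(ℝ, E') ∞ f x) :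
    Function.Surjective (mfderiv 𝓘(ℝ, E) 𝓘(ℝ, E') f x) := by
  have hd : MDifferentiableAt 𝓘(ℝ, E) 𝓘(ℝ, E') f x := h.contMDiffAt.mdifferentiableAt (by simp)
  obtain ⟨F, _, _, h⟩ := h
  have hw : ∀ y ∈ h.domChart.target,
      h.codChart (f (h.domChart.symm y)) = (h.equiv y).1 := by
    intro y hy
    have h0 : y ∈ (h.domChart.extend 𝓘(ℝ, E)).target := by simpa using hy
    exact h.writtenInCharts h0
  set φ := h.domChart
  set ψ := h.codChart
  have hxt : φ x ∈ φ.target := φ.map_source h.mem_domChart_source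
  have hfx : ψ (f x) = (h.equiv (φ x)).1 := by
    have := hw _ hxt
    rwa [φ.left_inv h.mem_domChart_source] at this
  let c : E' → E := fun u => h.equiv.symm (u, (h.equiv (φ x)).2)
  have hc : c (ψ (f x)) = φ x := by simp [c, hfx]
  have hcc : Continuous c := by fun_prop
  refine mfderiv_surjective_of_rightInverse
    (s := (φ.extend 𝓘(ℝ, E)).symm ∘ c ∘ ψ.extend 𝓘(ℝ, E')) ?_ hd ?_ ?_
  · change φ.symm (c (ψ (f x))) = x
    rw [hc, φ.left_inv h.mem_domChart_source]
  · refine MDifferentiableAt.comp (I' := 𝓘(ℝ, E)) _ ?_ (MDifferentiableAt.comp (I' := 𝓘(ℝ, E')) _ ?_ ?_)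
    · refine mdifferentiableAt_extend_symm h.domChart_mem_maximalAtlas ?_
      change c (ψ (f x)) ∈ _
      rw [hc]; exact hxt
    · exact (by fun_prop : DifferentiableAt ℝ c _).mdifferentiableAt
    · exact mdifferentiableAt_extend h.codChart_mem_maximalAtlas h.mem_codChart_source
  · have h1 : ∀ᶠ y in nhds (f x), c (ψ y) ∈ φ.target := by
      have : ContinuousAt (fun y => c (ψ y)) (f x) :=
        hcc.continuousAt.comp (ψ.continuousAt h.mem_codChart_source)
      exact this.eventually (φ.open_target.mem_nhds
        (show c (ψ (f x)) ∈ φ.target by rw [hc]; exact hxt))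
    filter_upwards [h1, ψ.open_source.mem_nhds h.mem_codChart_source] with y hy hy'
    change f (φ.symm (c (ψ y))) = y
    have h2 := hw _ hy
    have h3 : f (φ.symm (c (ψ y))) ∈ ψ.source :=
      h.mapsto_domChart_source_codChart_source (φ.map_target hy)
    apply ψ.injOn h3 hy'
    rw [h2]; simp [c]

end Calculus

section Metric

open Manifold

variable {n : ℕ} {EG : Type*} [NormedAddCommGroup EG] [NormedSpace ℝ EG]
  {G : Type*} [TopologicalSpace G] [ChartedSpace EG G] [Group G]
  (ρ : G →* (Aff n ≃ᵃⁱ[ℂ] Aff n))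
  (μ₁ : Cot n → Module.Dual ℝ (GroupLieAlgebra 𝓘(ℝ, EG) G)) (m k : ℕ)
  [ChartedSpace (EuclideanSpace ℝ (Fin m)) (zeroLevel ρ μ₁)]
  [ChartedSpace (EuclideanSpace ℝ (Fin k)) (HKQuotient ρ μ₁)]

/-- `μ⁻¹(0)` and `μ⁻¹(0)/G` are smooth, of dimensions `m` and `k`: the given manifold structures
are smooth, `μ⁻¹(0)` is an embedded submanifold of `T*A`, and the projection `μ⁻¹(0) → μ⁻¹(0)/G` is
a submersion. (This determines both manifold structures uniquely.) -/
structure IsSmoothQuotient : Prop where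
  level_isManifold : IsManifold 𝓘(ℝ, EuclideanSpace ℝ (Fin m)) ∞ (zeroLevel ρ μ₁)
  quotient_isManifold : IsManifold 𝓘(ℝ, EuclideanSpace ℝ (Fin k)) ∞ (HKQuotient ρ μ₁)
  isSmoothEmbedding : IsSmoothEmbedding 𝓘(ℝ, EuclideanSpace ℝ (Fin m)) 𝓘(ℝ, Cot n) ∞
    (Subtype.val : zeroLevel ρ μ₁ → Cot n)
  isSubmersion : IsSubmersion 𝓘(ℝ, EuclideanSpace ℝ (Fin m)) 𝓘(ℝ, EuclideanSpace ℝ (Fin k)) ∞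
    (proj ρ μ₁)

/-- The derivative at `x` of the inclusion `μ⁻¹(0) → T*A`. -/
def dIncl (x : zeroLevel ρ μ₁) : EuclideanSpace ℝ (Fin m) →L[ℝ] Cot n :=
  mfderiv 𝓘(ℝ, EuclideanSpace ℝ (Fin m)) 𝓘(ℝ, Cot n) (Subtype.val : zeroLevel ρ μ₁ → Cot n) x

/-- The derivative at `x` of the projection `μ⁻¹(0) → μ⁻¹(0)/G`. -/
def dProj (x : zeroLevel ρ μ₁) : EuclideanSpace ℝ (Fin m) →L[ℝ] EuclideanSpace ℝ (Fin k) :=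
  mfderiv 𝓘(ℝ, EuclideanSpace ℝ (Fin m)) 𝓘(ℝ, EuclideanSpace ℝ (Fin k)) (proj ρ μ₁) x

lemma re_inner_comm (u v : Cot n) : flatInner u v = flatInner v u := by
  exact inner_re_symm (𝕜 := ℂ) u v

lemma flatInner_self (u : Cot n) : flatInner u u = ‖u‖ ^ 2 := by
  simpa [flatInner] using (norm_sq_eq_re_inner (𝕜 := ℂ) u).symm

lemma flatInner_add_left (u v w : Cot n) :
    flatInner (u + v) w = flatInner u w + flatInner v w := by
  simp only [flatInner, inner_add_left, Complex.add_re]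

lemma flatInner_smul_left (c : ℝ) (u w : Cot n) :
    flatInner (c • u) w = c * flatInner u w := by
  have : c • u = (c : ℂ) • u := rfl
  rw [flatInner, this, inner_smul_left]
  simp [flatInner]

/-- The horizontal space in `T_x μ⁻¹(0)`: the orthogonal complement of the tangent space of the
`G`-orbit. As the orbit is a fibre of the projection, a submersion, its tangent space is the kernel
of the derivative of the projection. -/
def horizontal (x : zeroLevel ρ μ₁) : Submodule ℝ (EuclideanSpace ℝ (Fin m)) where
  carrier := {w | ∀ u, dProj ρ μ₁ m k x u = 0 →
    flatInner (dIncl ρ μ₁ m x w) (dIncl ρ μ₁ m x u) = 0}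
  zero_mem' u _ := by simp [flatInner]
  add_mem' {v w} hv hw u hu := by
    rw [map_add, flatInner_add_left, hv u hu, hw u hu, add_zero]
  smul_mem' c w hw u hu := by
    rw [map_smul, flatInner_smul_left, hw u hu, mul_zero]

variable {m k} {ρ μ₁}

lemma dIncl_injective (h : IsSmoothQuotient ρ μ₁ m k) (x : zeroLevel ρ μ₁) :
    Function.Injective (dIncl ρ μ₁ m x) :=
  mfderiv_injective_of_isImmersionAt (h.isSmoothEmbedding.isImmersion.isImmersionAt x)

lemma dProj_surjective (h : IsSmoothQuotient ρ μ₁ m k) (x : zeroLevel ρ μ₁) :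
    Function.Surjective (dProj ρ μ₁ m k x) :=
  mfderiv_surjective_of_isSubmersionAt (h.isSubmersion.isSubmersionAt x)

lemma exists_horizontal (x : zeroLevel ρ μ₁) (w : EuclideanSpace ℝ (Fin m)) :
    ∃ u ∈ horizontal ρ μ₁ m k x, dProj ρ μ₁ m k x u = dProj ρ μ₁ m k x w := by
  let _ : InnerProductSpace ℝ (Cot n) := InnerProductSpace.complexToReal
  let K : Submodule ℝ (Cot n) :=
    (LinearMap.ker (dProj ρ μ₁ m k x).toLinearMap).map (dIncl ρ μ₁ m x).toLinearMap
  have hK : FiniteDimensional ℝ K := inferInstance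
  obtain ⟨y, hy, z, hz, hyz⟩ := K.exists_add_mem_mem_orthogonal (dIncl ρ μ₁ m x w)
  obtain ⟨v, hv, rfl⟩ := hy
  have hv' : dProj ρ μ₁ m k x v = 0 := hv
  refine ⟨w - v, ?_, by rw [map_sub, hv', sub_zero]⟩
  intro u hu
  have h1 : dIncl ρ μ₁ m x (w - v) = z := by
    rw [map_sub, hyz]
    exact add_sub_cancel_left _ _
  rw [h1, re_inner_comm]
  exact hz _ ⟨u, hu, rfl⟩

lemma bijective_horizontal (h : IsSmoothQuotient ρ μ₁ m k) (x : zeroLevel ρ μ₁) :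
    Function.Bijective ((dProj ρ μ₁ m k x).toLinearMap ∘ₗ (horizontal ρ μ₁ m k x).subtype) := by
  constructor
  · rw [injective_iff_map_eq_zero]
    intro a ha
    have h1 := a.2 a.1 ha
    rw [flatInner_self] at h1
    have h2 : dIncl ρ μ₁ m x a.1 = 0 := by simpa using h1
    exact Subtype.ext (dIncl_injective h x (h2.trans (map_zero _).symm))
  · intro v
    obtain ⟨w, rfl⟩ := dProj_surjective h x v
    obtain ⟨u, hu, hu'⟩ := exists_horizontal (k := k) x w
    exact ⟨⟨u, hu⟩, hu'⟩

/-- The horizontal lift at `x` of a tangent vector of the quotient, as a vector of `T*A`. -/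
def horizontalLift (h : IsSmoothQuotient ρ μ₁ m k) (x : zeroLevel ρ μ₁) :
    EuclideanSpace ℝ (Fin k) →ₗ[ℝ] Cot n :=
  (dIncl ρ μ₁ m x).toLinearMap ∘ₗ (horizontal ρ μ₁ m k x).subtype ∘ₗ
    (LinearEquiv.ofBijective _ (bijective_horizontal h x)).symm.toLinearMap

lemma horizontalLift_dProj (h : IsSmoothQuotient ρ μ₁ m k) (x : zeroLevel ρ μ₁)
    {u : EuclideanSpace ℝ (Fin m)} (hu : u ∈ horizontal ρ μ₁ m k x) :
    horizontalLift h x (dProj ρ μ₁ m k x u) = dIncl ρ μ₁ m x u := by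
  have : (LinearEquiv.ofBijective _ (bijective_horizontal h x)).symm (dProj ρ μ₁ m k x u) =
      ⟨u, hu⟩ := by
    rw [LinearEquiv.symm_apply_eq]; rfl
  simp [horizontalLift, this]

lemma horizontalLift_injective (h : IsSmoothQuotient ρ μ₁ m k) (x : zeroLevel ρ μ₁) :
    Function.Injective (horizontalLift h x) :=
  (dIncl_injective h x).comp ((Submodule.subtype_injective _).comp
    (LinearEquiv.ofBijective _ (bijective_horizontal h x)).symm.injective)

/-- The inner product of the horizontal lifts at `x`. -/
def liftInner (h : IsSmoothQuotient ρ μ₁ m k) (x : zeroLevel ρ μ₁) :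
    EuclideanSpace ℝ (Fin k) →L[ℝ] EuclideanSpace ℝ (Fin k) →L[ℝ] ℝ :=
  LinearMap.toContinuousBilinearMap
    (LinearMap.mk₂ ℝ (fun v w => flatInner (horizontalLift h x v) (horizontalLift h x w))
      (fun u v w => by rw [map_add, flatInner_add_left])
      (fun c v w => by rw [map_smul, flatInner_smul_left, smul_eq_mul])
      (fun u v w => by
        rw [map_add, re_inner_comm, flatInner_add_left, re_inner_comm,
          re_inner_comm (horizontalLift h x w)])
      (fun c v w => by
        rw [map_smul, re_inner_comm, flatInner_smul_left, re_inner_comm, smul_eq_mul]))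

lemma liftInner_apply (h : IsSmoothQuotient ρ μ₁ m k) (x : zeroLevel ρ μ₁)
    (v w : EuclideanSpace ℝ (Fin k)) :
    liftInner h x v w = flatInner (horizontalLift h x v) (horizontalLift h x w) := rfl

lemma isVonNBounded_liftInner (h : IsSmoothQuotient ρ μ₁ m k) (x : zeroLevel ρ μ₁) :
    Bornology.IsVonNBounded ℝ {v : EuclideanSpace ℝ (Fin k) | liftInner h x v v < 1} := by
  obtain ⟨c, -, hc⟩ := (horizontalLift h x).exists_antilipschitzWith
    (LinearMap.ker_eq_bot.2 (horizontalLift_injective h x))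
  have hb : Bornology.IsBounded (horizontalLift h x ⁻¹' Metric.ball 0 1) :=
    hc.isBounded_preimage Metric.isBounded_ball
  refine (NormedSpace.isVonNBounded_of_isBounded ℝ hb).subset fun v hv => ?_
  have hv' : ‖horizontalLift h x v‖ ^ 2 < 1 := by
    rw [← flatInner_self]; exact hv
  simpa using (sq_lt_one_iff₀ (norm_nonneg _)).1 hv'

/-- The quotient metric on `μ⁻¹(0)/G`: the inner product of two tangent vectors at `q` is the inner
product of their horizontal lifts at a point of the orbit `q`. The choice of that point does not
matter, see `quotientMetric_dProj`. -/
def quotientMetric (h : IsSmoothQuotient ρ μ₁ m k) :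
    Bundle.RiemannianMetric
      (fun q : HKQuotient ρ μ₁ => TangentSpace 𝓘(ℝ, EuclideanSpace ℝ (Fin k)) q) where
  inner q := liftInner h q.out
  symm q v w := re_inner_comm _ _
  pos q v hv := by
    have h1 : horizontalLift h q.out v ≠ 0 := fun h0 =>
      hv (horizontalLift_injective h q.out (h0.trans (map_zero _).symm))
    change 0 < flatInner (horizontalLift h q.out v) (horizontalLift h q.out v)
    rw [flatInner_self]
    positivity
  continuousAt q := by
    have : Continuous fun v : EuclideanSpace ℝ (Fin k) => liftInner h q.out v v := by fun_prop
    exact this.continuousAt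
  isVonNBounded q := isVonNBounded_liftInner h q.out

lemma hasFDerivAt_isometryEquiv (e : Cot n ≃ᵢ Cot n) (p : Cot n) :
    HasFDerivAt e (e.toRealAffineIsometryEquiv.linearIsometryEquiv.toContinuousLinearEquiv :
      Cot n →L[ℝ] Cot n) p :=
  e.toRealAffineIsometryEquiv.toContinuousAffineEquiv.toContinuousAffineMap.hasFDerivAt

lemma flatInner_fderiv_isometryEquiv (e : Cot n ≃ᵢ Cot n) (p u v : Cot n) :
    flatInner (fderiv ℝ e p u) (fderiv ℝ e p v) = flatInner u v := by
  rw [(hasFDerivAt_isometryEquiv e p).fderiv]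
  have hL : ∀ w, ‖e.toRealAffineIsometryEquiv.linearIsometryEquiv w‖ = ‖w‖ :=
    fun w => LinearIsometryEquiv.norm_map _ w
  have pol : ∀ a b : Cot n, flatInner a b = (‖a + b‖ ^ 2 - ‖a‖ ^ 2 - ‖b‖ ^ 2) / 2 := fun a b => by
    rw [← flatInner_self, ← flatInner_self, ← flatInner_self, flatInner_add_left,
      re_inner_comm a (a + b), re_inner_comm b (a + b), flatInner_add_left, flatInner_add_left,
      re_inner_comm b a]
    ring
  rw [pol, pol, ← map_add]
  change (‖e.toRealAffineIsometryEquiv.linearIsometryEquiv (u + v)‖ ^ 2 -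
    ‖e.toRealAffineIsometryEquiv.linearIsometryEquiv u‖ ^ 2 -
    ‖e.toRealAffineIsometryEquiv.linearIsometryEquiv v‖ ^ 2) / 2 = _
  rw [hL, hL, hL]

/-- The restriction to `μ⁻¹(0)` of an isometry that preserves `μ⁻¹(0)`. -/
def restrictLevel (e : Cot n ≃ᵢ Cot n) (he : ∀ p ∈ zeroLevel ρ μ₁, e p ∈ zeroLevel ρ μ₁)
    (x : zeroLevel ρ μ₁) : zeroLevel ρ μ₁ :=
  ⟨e x, he x x.2⟩

/-- The derivative of `restrictLevel`. -/
def dRestrict (e : Cot n ≃ᵢ Cot n) (he : ∀ p ∈ zeroLevel ρ μ₁, e p ∈ zeroLevel ρ μ₁)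
    (x : zeroLevel ρ μ₁) : EuclideanSpace ℝ (Fin m) →L[ℝ] EuclideanSpace ℝ (Fin m) :=
  mfderiv 𝓘(ℝ, EuclideanSpace ℝ (Fin m)) 𝓘(ℝ, EuclideanSpace ℝ (Fin m)) (restrictLevel e he) x

lemma contMDiff_restrictLevel (h : IsSmoothQuotient ρ μ₁ m k) (e : Cot n ≃ᵢ Cot n)
    (he : ∀ p ∈ zeroLevel ρ μ₁, e p ∈ zeroLevel ρ μ₁) :
    ContMDiff 𝓘(ℝ, EuclideanSpace ℝ (Fin m)) 𝓘(ℝ, EuclideanSpace ℝ (Fin m)) ∞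
      (restrictLevel e he) := by
  have hinc := h.isSmoothEmbedding.contMDiff
  rw [ContMDiff.iff_comp_isImmersion h.isSmoothEmbedding.isImmersion]
  have hs : ContDiff ℝ ∞ e := e.toRealAffineIsometryEquiv.toContinuousAffineEquiv.toContinuousAffineMap.contDiff
  exact ⟨Continuous.subtype_mk (e.continuous.comp continuous_subtype_val) _,
    hs.contMDiff.comp hinc⟩

lemma dIncl_dRestrict (h : IsSmoothQuotient ρ μ₁ m k) (e : Cot n ≃ᵢ Cot n)
    (he : ∀ p ∈ zeroLevel ρ μ₁, e p ∈ zeroLevel ρ μ₁) (x : zeroLevel ρ μ₁)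
    (u : EuclideanSpace ℝ (Fin m)) :
    dIncl ρ μ₁ m (restrictLevel e he x) (dRestrict e he x u) =
      fderiv ℝ e x (dIncl ρ μ₁ m x u) := by
  have hinc := h.isSmoothEmbedding.contMDiff
  have hr := contMDiff_restrictLevel h e he
  have h1 := HasMFDerivAt.comp x
    (hinc (restrictLevel e he x) |>.mdifferentiableAt (by simp)).hasMFDerivAt
    (hr x |>.mdifferentiableAt (by simp)).hasMFDerivAt
  have h2 := HasMFDerivAt.comp x
    (hasFDerivAt_isometryEquiv e x.1).hasMFDerivAt
    (hinc x |>.mdifferentiableAt (by simp)).hasMFDerivAt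
  have h3 := hasMFDerivAt_unique h1 h2
  rw [(hasFDerivAt_isometryEquiv e x.1).fderiv]
  exact DFunLike.congr_fun h3 u

lemma dProj_dRestrict (h : IsSmoothQuotient ρ μ₁ m k) (e : Cot n ≃ᵢ Cot n)
    (he : ∀ p ∈ zeroLevel ρ μ₁, e p ∈ zeroLevel ρ μ₁)
    (hp : ∀ x, proj ρ μ₁ (restrictLevel e he x) = proj ρ μ₁ x) (x : zeroLevel ρ μ₁)
    (u : EuclideanSpace ℝ (Fin m)) :
    dProj ρ μ₁ m k (restrictLevel e he x) (dRestrict e he x u) = dProj ρ μ₁ m k x u := by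
  have hpr := h.isSubmersion.contMDiff
  have hr := contMDiff_restrictLevel h e he
  have h1 := HasMFDerivAt.comp x
    (hpr (restrictLevel e he x) |>.mdifferentiableAt (by simp)).hasMFDerivAt
    (hr x |>.mdifferentiableAt (by simp)).hasMFDerivAt
  have h2 := (hpr x |>.mdifferentiableAt (by simp)).hasMFDerivAt
  have hf : proj ρ μ₁ ∘ restrictLevel e he = proj ρ μ₁ := funext hp
  have key : ∀ (f : zeroLevel ρ μ₁ → HKQuotient ρ μ₁)
      (L : EuclideanSpace ℝ (Fin m) →L[ℝ] EuclideanSpace ℝ (Fin k)),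
      HasMFDerivAt 𝓘(ℝ, EuclideanSpace ℝ (Fin m)) 𝓘(ℝ, EuclideanSpace ℝ (Fin k)) f x L →
      f = proj ρ μ₁ → L = dProj ρ μ₁ m k x := by
    rintro f L hL rfl
    exact hasMFDerivAt_unique hL h2
  exact DFunLike.congr_fun (key _ _ h1 hf) u

section

variable [LieGroup 𝓘(ℝ, EG) ∞ G]

lemma fundamentalField_lieAd
    (hρ : ContMDiff (𝓘(ℝ, EG).prod 𝓘(ℝ, Aff n)) 𝓘(ℝ, Aff n) ∞
      (fun a : G × Aff n => ρ a.1 a.2)) (g : G) (ξ : GroupLieAlgebra 𝓘(ℝ, EG) G) (z : Aff n) :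
    (ρ g).linearIsometryEquiv (fundamentalField (E := Aff n) (fun g x => ρ g x) (lieAd g⁻¹ ξ) z) =
      fundamentalField (E := Aff n) (fun g x => ρ g x) ξ (ρ g z) := by
  have horb : ∀ y : Aff n, ContMDiff 𝓘(ℝ, EG) 𝓘(ℝ, Aff n) ∞ (fun a : G => ρ a y) := fun y =>
    hρ.comp (contMDiff_id.prodMk contMDiff_const)
  have hconj : ContMDiff 𝓘(ℝ, EG) 𝓘(ℝ, EG) ∞ (fun a : G => g⁻¹ * a * g⁻¹⁻¹) :=
    (contMDiff_mul_right (a := g⁻¹⁻¹)).comp (contMDiff_mul_left (a := g⁻¹))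
  have hone : g⁻¹ * 1 * g⁻¹⁻¹ = 1 := by group
  have haff : ∀ q, HasFDerivAt (ρ g) (((ρ g).linearIsometryEquiv.toContinuousLinearEquiv :
      Aff n →L[ℂ] Aff n).restrictScalars ℝ) q := fun q =>
    ((ρ g).toContinuousAffineEquiv.toContinuousAffineMap.hasFDerivAt.restrictScalars ℝ)
  have h1 := HasMFDerivAt.comp (I := 𝓘(ℝ, EG)) (I' := 𝓘(ℝ, EG)) (I'' := 𝓘(ℝ, Aff n)) (1 : G)
    (f := fun a : G => g⁻¹ * a * g⁻¹⁻¹) (g := fun a : G => ρ a z)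
    (g' := (mfderiv 𝓘(ℝ, EG) 𝓘(ℝ, Aff n) (fun a : G => ρ a z) 1 : EG →L[ℝ] Aff n))
    (by
      rw [hone]
      exact ((horb z) 1 |>.mdifferentiableAt (by simp)).hasMFDerivAt)
    (hconj 1 |>.mdifferentiableAt (by simp)).hasMFDerivAt
  have h2 := HasMFDerivAt.comp (I := 𝓘(ℝ, EG)) (I' := 𝓘(ℝ, Aff n)) (I'' := 𝓘(ℝ, Aff n)) (1 : G)
    (f := fun a : G => ρ (g⁻¹ * a * g⁻¹⁻¹) z) (g := ρ g)
    (haff _).hasMFDerivAt h1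
  have h3 : HasMFDerivAt 𝓘(ℝ, EG) 𝓘(ℝ, Aff n) (fun a : G => ρ a (ρ g z)) 1 _ :=
    ((horb (ρ g z)) 1 |>.mdifferentiableAt (by simp)).hasMFDerivAt
  have hf : (ρ g) ∘ (fun a : G => ρ (g⁻¹ * a * g⁻¹⁻¹) z) = fun a : G => ρ a (ρ g z) := by
    funext a
    have e : a * g = g * (g⁻¹ * a * g⁻¹⁻¹) := by group
    change (ρ g * ρ (g⁻¹ * a * g⁻¹⁻¹)) z = (ρ a * ρ g) z
    rw [← map_mul, ← map_mul, e]
  have key : ∀ (f : G → Aff n) (L : EG →L[ℝ] Aff n),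
      HasMFDerivAt 𝓘(ℝ, EG) 𝓘(ℝ, Aff n) f 1 L → f = (fun a : G => ρ a (ρ g z)) →
      L = mfderiv 𝓘(ℝ, EG) 𝓘(ℝ, Aff n) (fun a : G => ρ a (ρ g z)) 1 := by
    rintro f L hL rfl
    exact hasMFDerivAt_unique hL h3
  exact DFunLike.congr_fun (key _ _ h2 hf) ξ

lemma cotLift_mem_zeroLevel
    (hρ : ContMDiff (𝓘(ℝ, EG).prod 𝓘(ℝ, Aff n)) 𝓘(ℝ, Aff n) ∞
      (fun a : G × Aff n => ρ a.1 a.2)) (hμ : IsMomentMapOne ρ μ₁) (g : G) (p : Cot n)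
    (hp : p ∈ zeroLevel ρ μ₁) : cotLift (ρ g) p ∈ zeroLevel ρ μ₁ := by
  have hc : ∀ ξ : GroupLieAlgebra 𝓘(ℝ, EG) G, complexMoment ρ (cotLift (ρ g) p) ξ = complexMoment ρ p (lieAd g⁻¹ ξ) := by
    intro ξ
    change pairing (conjVec ((ρ g).linearIsometryEquiv (conjVec p.snd)))
      (fundamentalField (E := Aff n) (fun g x => ρ g x) ξ (ρ g p.fst)) = pairing p.snd
      (fundamentalField (E := Aff n) (fun g x => ρ g x) (lieAd g⁻¹ ξ) p.fst)
    rw [← fundamentalField_lieAd hρ]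
    exact pairing_lift _ _ _
  have hp' : moment ρ μ₁ p = 0 := hp
  change moment ρ μ₁ (cotLift (ρ g) p) = 0
  funext i
  ext ξ
  have hi : moment ρ μ₁ p i (lieAd g⁻¹ ξ) = 0 := by rw [hp']; rfl
  refine Eq.trans ?_ hi
  fin_cases i
  · exact hμ.equivariant g p ξ
  · exact congrArg Complex.re (hc ξ)
  · exact congrArg Complex.im (hc ξ)

/-- The metric `quotientMetric` makes the projection a Riemannian submersion: on horizontal vectors,
at every point, the derivative of the projection is isometric. -/
theorem quotientMetric_dProj
    (hρ : ContMDiff (𝓘(ℝ, EG).prod 𝓘(ℝ, Aff n)) 𝓘(ℝ, Aff n) ∞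
      (fun a : G × Aff n => ρ a.1 a.2)) (hμ : IsMomentMapOne ρ μ₁)
    (h : IsSmoothQuotient ρ μ₁ m k) (x : zeroLevel ρ μ₁) (u v : EuclideanSpace ℝ (Fin m))
    (hu : u ∈ horizontal ρ μ₁ m k x) (hv : v ∈ horizontal ρ μ₁ m k x) :
    (quotientMetric h).inner (proj ρ μ₁ x) (dProj ρ μ₁ m k x u) (dProj ρ μ₁ m k x v) =
      flatInner (dIncl ρ μ₁ m x u) (dIncl ρ μ₁ m x v) := by
  obtain ⟨g, hg⟩ : ∃ g : G, cotLift (ρ g) x.1 = (proj ρ μ₁ x).out.1 :=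
    Quotient.exact (s := orbitSetoid ρ μ₁) (Quotient.out_eq (proj ρ μ₁ x)).symm
  have hmem := cotLift_mem_zeroLevel hρ hμ
  have hpr : ∀ (g : G) (y : zeroLevel ρ μ₁),
      proj ρ μ₁ (restrictLevel (cotLift (ρ g)) (hmem g) y) = proj ρ μ₁ y := fun g y =>
    (Quotient.sound (s := orbitSetoid ρ μ₁) ⟨g, rfl⟩).symm
  have hy : restrictLevel (cotLift (ρ g)) (hmem g) x = (proj ρ μ₁ x).out := Subtype.ext hg
  have hinv : ∀ p : Cot n, cotLift (ρ g⁻¹) (cotLift (ρ g) p) = p := fun p => by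
    rw [← IsometryEquiv.mul_apply, ← map_mul, ← map_mul]; simp
  have hinv' : ∀ p : Cot n, cotLift (ρ g) (cotLift (ρ g⁻¹) p) = p := fun p => by
    rw [← IsometryEquiv.mul_apply, ← map_mul, ← map_mul]; simp
  have hhor : ∀ w ∈ horizontal ρ μ₁ m k x, dRestrict (cotLift (ρ g)) (hmem g) x w ∈
      horizontal ρ μ₁ m k (restrictLevel (cotLift (ρ g)) (hmem g) x) := by
    intro w hw a ha
    set y := restrictLevel (cotLift (ρ g)) (hmem g) x with hydef
    have hx : restrictLevel (cotLift (ρ g⁻¹)) (hmem g⁻¹) y = x := Subtype.ext (hinv x.1)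
    have h1 : dProj ρ μ₁ m k x (dRestrict (cotLift (ρ g⁻¹)) (hmem g⁻¹) y a) = 0 := by
      have := dProj_dRestrict h _ (hmem g⁻¹) (hpr g⁻¹) y a
      rwa [hx, ha] at this
    have h2 := dIncl_dRestrict h _ (hmem g⁻¹) y a
    rw [hx] at h2
    have h3 := hw _ h1
    rw [h2] at h3
    have h4 : fderiv ℝ (cotLift (ρ g)) x.1 (fderiv ℝ (cotLift (ρ g⁻¹)) y.1 (dIncl ρ μ₁ m y a)) =
        dIncl ρ μ₁ m y a := by
      have hd := (hasFDerivAt_isometryEquiv (cotLift (ρ g)) x.1)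
      have hd' := (hasFDerivAt_isometryEquiv (cotLift (ρ g⁻¹)) y.1)
      have hx' : cotLift (ρ g⁻¹) y.1 = x.1 := hinv x.1
      rw [← hx'] at hd
      have h5 := (hd.comp y.1 hd').congr_of_eventuallyEq
        (f₁ := id) (.of_forall fun p => (hinv' p).symm)
      have h6 := h5.unique (hasFDerivAt_id y.1)
      rw [hd'.fderiv, ← hx', hd.fderiv]
      exact DFunLike.congr_fun h6 _
    rw [dIncl_dRestrict h, ← h4, flatInner_fderiv_isometryEquiv]
    exact h3
  have hlift : ∀ w ∈ horizontal ρ μ₁ m k x,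
      horizontalLift h (proj ρ μ₁ x).out (dProj ρ μ₁ m k x w) =
        fderiv ℝ (cotLift (ρ g)) x.1 (dIncl ρ μ₁ m x w) := by
    intro w hw
    rw [← hy, ← dProj_dRestrict h _ (hmem g) (hpr g) x w, horizontalLift_dProj h _ (hhor w hw),
      dIncl_dRestrict h]
  change flatInner (horizontalLift h (proj ρ μ₁ x).out (dProj ρ μ₁ m k x u))
    (horizontalLift h (proj ρ μ₁ x).out (dProj ρ μ₁ m k x v)) = _
  rw [hlift u hu, hlift v hv, flatInner_fderiv_isometryEquiv]

end

end Metric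

end HKQ

/-! The isometries `σ t` are affine maps of the flat space `T*A`, so a vector field `Y` generated by
`H` is affine on `T*A` and `‖Y q‖ ≤ C · dist p q + B` (`exists_norm_fundamentalField_le`). The field
`Ȳ` on the quotient is the projection of `Y` restricted to `μ⁻¹(0)`
(`exists_dProj_eq_fundamentalField`). The projection is a Riemannian submersion, hence does not
lengthen vectors (`quotientMetric_dProj_le`), so `‖Ȳ‖` at `q` is at most `‖Y y‖` for every `y` in
the orbit `q`. Taking `y` almost nearest to a fixed point `x₀` over the base point bounds `‖Ȳ‖`
linearly in the Euclidean distance from `x₀` to the orbit.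

It remains to see that this distance is at most the Riemannian distance in the quotient
(`orbitDist_le_riemannianEDist`). Usually one lifts a path horizontally and compares lengths, but a
global horizontal lift may fail to exist. Instead, the function `orbitDist x₀` is followed along a
C¹ path `γ` of the quotient. Since `G` acts by isometries, its increments are bounded by those of
any local lift of `γ`. Smooth lifts show that it is locally Lipschitz; a lift with horizontal
velocity at the single time `t` shows that its derivative there is at most the speed of `γ`.
Integrating gives the claim.

The action descends because `H` permutes the `G`-orbits in `μ⁻¹(0)`. It is smooth because
submersions have smooth local sections, and isometric because an isometry that preserves the
vertical directions also preserves their orthogonal complements. -/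

namespace HKQ

/-! ### Local sections of submersions and local lifts of curves -/

section Submersion

open Manifold

variable {E E' : Type*} [NormedAddCommGroup E] [NormedSpace ℝ E]
  [NormedAddCommGroup E'] [NormedSpace ℝ E']
  {M N : Type*} [TopologicalSpace M] [ChartedSpace E M]
  [TopologicalSpace N] [ChartedSpace E' N] {f : M → N}

/-- A submersion has a smooth local section through every point. -/
lemma exists_contMDiffAt_section {x : M} (h : IsSubmersionAt 𝓘(ℝ, E) 𝓘(ℝ, E') ∞ f x) :
    ∃ s : N → M, s (f x) = x ∧ ContMDiffAt 𝓘(ℝ, E') 𝓘(ℝ, E) ∞ s (f x) ∧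
      ∀ᶠ y in nhds (f x), f (s y) = y := by
  obtain ⟨F, _, _, h⟩ := h
  have hw : ∀ y ∈ h.domChart.target,
      h.codChart (f (h.domChart.symm y)) = (h.equiv y).1 := by
    intro y hy
    have h0 : y ∈ (h.domChart.extend 𝓘(ℝ, E)).target := by simpa using hy
    exact h.writtenInCharts h0
  set φ := h.domChart
  set ψ := h.codChart
  have hxt : φ x ∈ φ.target := φ.map_source h.mem_domChart_source
  have hfx : ψ (f x) = (h.equiv (φ x)).1 := by
    have := hw _ hxt
    rwa [φ.left_inv h.mem_domChart_source] at this
  -- In adapted charts `f` is the first projection of a product; the section keeps the second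
  -- coordinate fixed at its value at `x`.
  let c : E' → E := fun u => h.equiv.symm (u, (h.equiv (φ x)).2)
  have hc : c (ψ (f x)) = φ x := by simp [c, hfx]
  have hcc : ContDiff ℝ ∞ c := by fun_prop
  have hψ : ContMDiffAt 𝓘(ℝ, E') 𝓘(ℝ, E') ∞ ψ (f x) :=
    (contMDiffOn_of_mem_maximalAtlas h.codChart_mem_maximalAtlas).contMDiffAt
      (ψ.open_source.mem_nhds h.mem_codChart_source)
  have hφ : ContMDiffAt 𝓘(ℝ, E) 𝓘(ℝ, E) ∞ φ.symm (c (ψ (f x))) := by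
    rw [hc]
    exact (contMDiffOn_symm_of_mem_maximalAtlas h.domChart_mem_maximalAtlas).contMDiffAt
      (φ.open_target.mem_nhds hxt)
  refine ⟨fun y => φ.symm (c (ψ y)), ?_, ?_, ?_⟩
  · change φ.symm (c (ψ (f x))) = x
    rw [hc, φ.left_inv h.mem_domChart_source]
  · exact hφ.comp (f x) ((hcc.contMDiff _).comp (f x) hψ)
  · have h1 : ∀ᶠ y in nhds (f x), c (ψ y) ∈ φ.target := by
      have : ContinuousAt (fun y => c (ψ y)) (f x) :=
        hcc.continuous.continuousAt.comp (ψ.continuousAt h.mem_codChart_source)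
      exact this.eventually (φ.open_target.mem_nhds
        (show c (ψ (f x)) ∈ φ.target by rw [hc]; exact hxt))
    filter_upwards [h1, ψ.open_source.mem_nhds h.mem_codChart_source] with y hy hy'
    have h2 := hw _ hy
    have h3 : f (φ.symm (c (ψ y))) ∈ ψ.source :=
      h.mapsto_domChart_source_codChart_source (φ.map_target hy)
    apply ψ.injOn h3 hy'
    rw [h2]; simp [c]

/-- The chain rule for the velocity of a curve. -/
lemma HasMFDerivAt.comp_curve {c : ℝ → M} {t : ℝ} {x : M} (hx : c t = x) {u : E} {L : E →L[ℝ] E'}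
    (hf : HasMFDerivAt 𝓘(ℝ, E) 𝓘(ℝ, E') f x L)
    (hc : HasMFDerivAt 𝓘(ℝ, ℝ) 𝓘(ℝ, E) c t
      (ContinuousLinearMap.toSpanSingleton ℝ u : ℝ →L[ℝ] E)) :
    HasMFDerivAt 𝓘(ℝ, ℝ) 𝓘(ℝ, E') (fun s => f (c s)) t
      (ContinuousLinearMap.toSpanSingleton ℝ (L u) : ℝ →L[ℝ] E') := by
  subst hx
  have h := HasMFDerivAt.comp t hf hc
  have h2 : L.comp (ContinuousLinearMap.toSpanSingleton ℝ u : ℝ →L[ℝ] E) =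
      ContinuousLinearMap.toSpanSingleton ℝ (L u) := by
    ext; simp
  exact h2 ▸ h

lemma hasDerivAt_of_hasMFDerivAt {c : ℝ → E} {t : ℝ} {u : E}
    (hc : HasMFDerivAt 𝓘(ℝ, ℝ) 𝓘(ℝ, E) c t
      (ContinuousLinearMap.toSpanSingleton ℝ u : ℝ →L[ℝ] E)) : HasDerivAt c u t :=
  hasMFDerivAt_iff_hasFDerivAt.1 hc

/-- A curve in the base of a submersion lifts locally, with any prescribed initial velocity that
projects to the velocity of the curve. -/
lemma exists_curve_lift {x : M} (h : IsSubmersionAt 𝓘(ℝ, E) 𝓘(ℝ, E') ∞ f x)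
    {γ : ℝ → N} {t : ℝ} (hγ : γ t = f x) {v : E'}
    (hv : HasMFDerivAt 𝓘(ℝ, ℝ) 𝓘(ℝ, E') γ t (ContinuousLinearMap.toSpanSingleton ℝ v : ℝ →L[ℝ] E'))
    {u : E} (hu : (mfderiv 𝓘(ℝ, E) 𝓘(ℝ, E') f x : E →L[ℝ] E') u = v) :
    ∃ c : ℝ → M, c t = x ∧
      HasMFDerivAt 𝓘(ℝ, ℝ) 𝓘(ℝ, E) c t (ContinuousLinearMap.toSpanSingleton ℝ u : ℝ →L[ℝ] E) ∧
      ∀ᶠ s in nhds t, f (c s) = γ s := by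
  have hd : MDifferentiableAt 𝓘(ℝ, E) 𝓘(ℝ, E') f x := h.contMDiffAt.mdifferentiableAt (by simp)
  obtain ⟨F, _, _, h⟩ := h
  have hw : ∀ y ∈ h.domChart.target,
      h.codChart (f (h.domChart.symm y)) = (h.equiv y).1 := by
    intro y hy
    have h0 : y ∈ (h.domChart.extend 𝓘(ℝ, E)).target := by simpa using hy
    exact h.writtenInCharts h0
  set φ := h.domChart
  set ψ := h.codChart
  have hxt : φ x ∈ φ.target := φ.map_source h.mem_domChart_source
  have hfx : ψ (f x) = (h.equiv (φ x)).1 := by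
    have := hw _ hxt
    rwa [φ.left_inv h.mem_domChart_source] at this
  have hψ : MDifferentiableAt 𝓘(ℝ, E') 𝓘(ℝ, E') ψ (f x) :=
    mdifferentiableAt_extend h.codChart_mem_maximalAtlas h.mem_codChart_source
  have hφ : MDifferentiableAt 𝓘(ℝ, E) 𝓘(ℝ, E) φ x :=
    mdifferentiableAt_extend h.domChart_mem_maximalAtlas h.mem_domChart_source
  have hφ' : MDifferentiableAt 𝓘(ℝ, E) 𝓘(ℝ, E) φ.symm (φ x) :=
    mdifferentiableAt_extend_symm h.domChart_mem_maximalAtlas hxt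
  let A : E →L[ℝ] E := mfderiv 𝓘(ℝ, E) 𝓘(ℝ, E) φ x
  let A' : E →L[ℝ] E := mfderiv 𝓘(ℝ, E) 𝓘(ℝ, E) φ.symm (φ x)
  let B : E' →L[ℝ] E' := mfderiv 𝓘(ℝ, E') 𝓘(ℝ, E') ψ (f x)
  let D : E →L[ℝ] E' := mfderiv 𝓘(ℝ, E) 𝓘(ℝ, E') f x
  have hA'A : ∀ w, A' (A w) = w := by
    have h1 : HasMFDerivAt 𝓘(ℝ, E) 𝓘(ℝ, E) (φ.symm ∘ φ) x (A'.comp A) :=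
      HasMFDerivAt.comp x hφ'.hasMFDerivAt hφ.hasMFDerivAt
    have h2 : HasMFDerivAt 𝓘(ℝ, E) 𝓘(ℝ, E) (φ.symm ∘ φ) x (ContinuousLinearMap.id ℝ E) := by
      refine (hasMFDerivAt_id x).congr_of_eventuallyEq ?_
      filter_upwards [φ.open_source.mem_nhds h.mem_domChart_source] with y hy
      exact φ.left_inv hy
    exact fun w => DFunLike.congr_fun (hasMFDerivAt_unique h1 h2) w
  -- Since `f` is the first projection in charts, `D w` determines exactly the first component of `A
  -- w`.
  have hBD : ∀ w, B (D w) = (h.equiv (A w)).1 := by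
    have h1 : HasMFDerivAt 𝓘(ℝ, E) 𝓘(ℝ, E') (ψ ∘ f) x (B.comp D) :=
      HasMFDerivAt.comp x hψ.hasMFDerivAt hd.hasMFDerivAt
    let L : E →L[ℝ] E' := (ContinuousLinearMap.fst ℝ E' F).comp (h.equiv : E →L[ℝ] E' × F)
    have h2 : HasMFDerivAt 𝓘(ℝ, E) 𝓘(ℝ, E') (ψ ∘ f) x (L.comp A) := by
      refine (HasMFDerivAt.comp x (L.hasFDerivAt (x := φ x)).hasMFDerivAt
        hφ.hasMFDerivAt).congr_of_eventuallyEq ?_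
      filter_upwards [φ.open_source.mem_nhds h.mem_domChart_source] with y hy
      have := hw _ (φ.map_source hy)
      rw [φ.left_inv hy] at this
      exact this
    exact fun w => DFunLike.congr_fun (hasMFDerivAt_unique h1 h2) w
  -- The first coordinate is forced by `γ`. The second is free, and moves at the constant speed
  -- prescribed by `u`; by `hBD` the velocity at `t` is then `A u`.
  let e : ℝ → E := fun s => h.equiv.symm (ψ (γ s), (h.equiv (φ x)).2 + (s - t) • (h.equiv (A u)).2)
  have het : e t = φ x := by simp [e, hγ, hfx]
  have hψγ : HasDerivAt (fun s => ψ (γ s)) (B v) t :=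
    hasDerivAt_of_hasMFDerivAt (HasMFDerivAt.comp_curve hγ hψ.hasMFDerivAt hv)
  have he : HasDerivAt e (A u) t := by
    have h1 : HasDerivAt (fun s : ℝ => (h.equiv (φ x)).2 + (s - t) • (h.equiv (A u)).2)
        ((h.equiv (A u)).2) t := by
      simpa using (((hasDerivAt_id t).sub_const t).smul_const (h.equiv (A u)).2).const_add
        (h.equiv (φ x)).2
    have h2 := (h.equiv.symm : E' × F →L[ℝ] E).hasFDerivAt.comp_hasDerivAt t (hψγ.prodMk h1)
    have h3 : h.equiv.symm (B v, (h.equiv (A u)).2) = A u := by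
      rw [← hu]
      change h.equiv.symm (B (D u), _) = _
      rw [hBD]; simp
    rw [← h3]
    exact h2
  have hce : ContinuousAt e t := he.continuousAt
  refine ⟨fun s => φ.symm (e s), ?_, ?_, ?_⟩
  · change φ.symm (e t) = x
    rw [het, φ.left_inv h.mem_domChart_source]
  · have h1 := HasMFDerivAt.comp_curve het hφ'.hasMFDerivAt he.hasFDerivAt.hasMFDerivAt
    have h2 : A' (A u) = u := hA'A u
    exact h2 ▸ h1
  · have h1 : ∀ᶠ s in nhds t, e s ∈ φ.target :=
      hce.eventually (φ.open_target.mem_nhds (show e t ∈ φ.target by rw [het]; exact hxt))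
    have h2 : ∀ᶠ s in nhds t, γ s ∈ ψ.source :=
      hv.continuousAt.eventually (ψ.open_source.mem_nhds
        (show γ t ∈ ψ.source by rw [hγ]; exact h.mem_codChart_source))
    filter_upwards [h1, h2] with s hs hs'
    have h3 : f (φ.symm (e s)) ∈ ψ.source :=
      h.mapsto_domChart_source_codChart_source (φ.map_target hs)
    apply ψ.injOn h3 hs'
    rw [hw _ hs]; simp [e]

end Submersion

end HKQ

namespace HKQ

/-! ### The induced action on the quotient: existence, smoothness, isometry -/

section Descent

open Manifold

variable {n : ℕ} {EG : Type*} [NormedAddCommGroup EG] [NormedSpace ℝ EG]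
  {G : Type*} [TopologicalSpace G] [ChartedSpace EG G] [Group G]
  {ρ : G →* (Aff n ≃ᵃⁱ[ℂ] Aff n)}
  {μ₁ : Cot n → Module.Dual ℝ (GroupLieAlgebra 𝓘(ℝ, EG) G)}
  {H : Type*} [Group H]

lemma proj_cotLift {x y : zeroLevel ρ μ₁} {g : G} (h : cotLift (ρ g) x.1 = y.1) :
    proj ρ μ₁ x = proj ρ μ₁ y :=
  Quotient.sound (s := orbitSetoid ρ μ₁) ⟨g, h⟩

lemma exists_cotLift_of_proj_eq {x y : zeroLevel ρ μ₁} (h : proj ρ μ₁ x = proj ρ μ₁ y) :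
    ∃ g : G, cotLift (ρ g) x.1 = y.1 :=
  Quotient.exact (s := orbitSetoid ρ μ₁) h

lemma proj_surjective : Function.Surjective (proj ρ μ₁) := Quotient.mk_surjective

/-- Normalizing means `σ t ∘ g = g' ∘ σ t` for some `g'` in the image of `G`, so `σ t` carries
orbits to orbits. Only the images of the two groups among the isometries of `T*A` enter. -/
lemma proj_restrictLevel_eq {σ : H →* (Cot n ≃ᵢ Cot n)}
    (hpres : ∀ (t : H), ∀ p ∈ zeroLevel ρ μ₁, σ t p ∈ zeroLevel ρ μ₁)
    (hnorm : σ.range ≤ Subgroup.normalizer (cotLift.comp ρ).range) (t : H)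
    {x y : zeroLevel ρ μ₁} (h : proj ρ μ₁ x = proj ρ μ₁ y) :
    proj ρ μ₁ (restrictLevel (σ t) (hpres t) x) = proj ρ μ₁ (restrictLevel (σ t) (hpres t) y) := by
  obtain ⟨g, hg⟩ := exists_cotLift_of_proj_eq h
  have h1 := hnorm ⟨t, rfl⟩
  rw [Subgroup.mem_normalizer_iff] at h1
  obtain ⟨g', hg'⟩ := (h1 (cotLift (ρ g))).1 ⟨g, rfl⟩
  refine proj_cotLift (g := g') ?_
  have h2 : cotLift (ρ g') * σ t = σ t * cotLift (ρ g) := by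
    have : cotLift (ρ g') = σ t * cotLift (ρ g) * (σ t)⁻¹ := hg'
    rw [this]; group
  have h3 := DFunLike.congr_fun h2 x.1
  rw [IsometryEquiv.mul_apply, IsometryEquiv.mul_apply, hg] at h3
  exact h3

/-- The action on the quotient induced by an action that preserves the level set and normalizes
`G`. -/
def quotientAction (σ : H →* (Cot n ≃ᵢ Cot n))
    (hpres : ∀ (t : H), ∀ p ∈ zeroLevel ρ μ₁, σ t p ∈ zeroLevel ρ μ₁)
    (hnorm : σ.range ≤ Subgroup.normalizer (cotLift.comp ρ).range) :
    H →* Equiv.Perm (HKQuotient ρ μ₁) :=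
  -- Once the action laws are known, `MulAction.toPermHom` supplies bijectivity.
  letI : MulAction H (HKQuotient ρ μ₁) :=
    { smul := fun t => Quotient.lift (fun x => proj ρ μ₁ (restrictLevel (σ t) (hpres t) x))
        fun _ _ h => proj_restrictLevel_eq hpres hnorm t (Quotient.sound h)
      one_smul := by
        rintro ⟨x⟩
        exact congrArg (proj ρ μ₁) (Subtype.ext (by simp [restrictLevel]))
      mul_smul := by
        rintro s t ⟨x⟩
        exact congrArg (proj ρ μ₁) (Subtype.ext (by simp [restrictLevel])) }
  MulAction.toPermHom H (HKQuotient ρ μ₁)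

lemma quotientAction_proj (σ : H →* (Cot n ≃ᵢ Cot n))
    (hpres : ∀ (t : H), ∀ p ∈ zeroLevel ρ μ₁, σ t p ∈ zeroLevel ρ μ₁)
    (hnorm : σ.range ≤ Subgroup.normalizer (cotLift.comp ρ).range) (t : H) (x : zeroLevel ρ μ₁) :
    quotientAction σ hpres hnorm t (proj ρ μ₁ x) =
      proj ρ μ₁ (restrictLevel (σ t) (hpres t) x) := rfl

variable {m k : ℕ}
  [ChartedSpace (EuclideanSpace ℝ (Fin m)) (zeroLevel ρ μ₁)]
  [ChartedSpace (EuclideanSpace ℝ (Fin k)) (HKQuotient ρ μ₁)]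

section Smooth

variable {EH : Type*} [NormedAddCommGroup EH] [NormedSpace ℝ EH]
  [TopologicalSpace H] [ChartedSpace EH H]

/-- A continuous map into an immersed manifold is smooth as soon as its composite with the immersion
is. Continuity is clear because `μ⁻¹(0)` carries the subspace topology. -/
lemma contMDiff_restrictLevel_action (h : IsSmoothQuotient ρ μ₁ m k)
    {σ : H →* (Cot n ≃ᵢ Cot n)}
    (hσ : ContMDiff (𝓘(ℝ, EH).prod 𝓘(ℝ, Cot n)) 𝓘(ℝ, Cot n) ∞ (fun a : H × Cot n => σ a.1 a.2))
    (hpres : ∀ (t : H), ∀ p ∈ zeroLevel ρ μ₁, σ t p ∈ zeroLevel ρ μ₁) :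
    ContMDiff (𝓘(ℝ, EH).prod 𝓘(ℝ, EuclideanSpace ℝ (Fin m))) 𝓘(ℝ, EuclideanSpace ℝ (Fin m)) ∞
      (fun a : H × zeroLevel ρ μ₁ => restrictLevel (σ a.1) (hpres a.1) a.2) := by
  have h1 : ContMDiff (𝓘(ℝ, EH).prod 𝓘(ℝ, EuclideanSpace ℝ (Fin m))) 𝓘(ℝ, Cot n) ∞
      (fun a : H × zeroLevel ρ μ₁ => σ a.1 a.2.1) :=
    hσ.comp (contMDiff_fst.prodMk (h.isSmoothEmbedding.contMDiff.comp contMDiff_snd))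
  rw [ContMDiff.iff_comp_isImmersion h.isSmoothEmbedding.isImmersion]
  exact ⟨Continuous.subtype_mk h1.continuous _, h1⟩

/-- Near a given point the action is the composite of a smooth local section of the projection, the
action on `μ⁻¹(0)`, and the projection. -/
lemma contMDiff_quotientAction (h : IsSmoothQuotient ρ μ₁ m k)
    {σ : H →* (Cot n ≃ᵢ Cot n)}
    (hσ : ContMDiff (𝓘(ℝ, EH).prod 𝓘(ℝ, Cot n)) 𝓘(ℝ, Cot n) ∞ (fun a : H × Cot n => σ a.1 a.2))
    (hpres : ∀ (t : H), ∀ p ∈ zeroLevel ρ μ₁, σ t p ∈ zeroLevel ρ μ₁)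
    (hnorm : σ.range ≤ Subgroup.normalizer (cotLift.comp ρ).range) :
    ContMDiff (𝓘(ℝ, EH).prod 𝓘(ℝ, EuclideanSpace ℝ (Fin k))) 𝓘(ℝ, EuclideanSpace ℝ (Fin k)) ∞
      (fun a : H × HKQuotient ρ μ₁ => quotientAction σ hpres hnorm a.1 a.2) := by
  rintro ⟨t, q⟩
  obtain ⟨x, rfl⟩ := proj_surjective q
  obtain ⟨s, hsx, hs, hps⟩ := exists_contMDiffAt_section (h.isSubmersion.isSubmersionAt x)
  have h1 : ContMDiffAt (𝓘(ℝ, EH).prod 𝓘(ℝ, EuclideanSpace ℝ (Fin k)))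
      (𝓘(ℝ, EH).prod 𝓘(ℝ, EuclideanSpace ℝ (Fin m))) ∞
      (fun a : H × HKQuotient ρ μ₁ => (a.1, s a.2)) (t, proj ρ μ₁ x) :=
    contMDiffAt_fst.prodMk (ContMDiffAt.comp (t, proj ρ μ₁ x) hs contMDiffAt_snd)
  have h2 := (h.isSubmersion.contMDiff.comp (contMDiff_restrictLevel_action h hσ hpres)).contMDiffAt.comp
    (t, proj ρ μ₁ x) h1
  refine h2.congr_of_eventuallyEq ?_
  have h3 : ∀ᶠ a : H × HKQuotient ρ μ₁ in nhds (t, proj ρ μ₁ x), proj ρ μ₁ (s a.2) = a.2 :=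
    (continuous_snd.tendsto (t, proj ρ μ₁ x)).eventually hps
  filter_upwards [h3] with a ha
  conv_lhs => rw [← ha]
  rfl

/-- The derivative of the induced map on the quotient. -/
lemma mfderiv_quotient_dProj (h : IsSmoothQuotient ρ μ₁ m k) (e : Cot n ≃ᵢ Cot n)
    (he : ∀ p ∈ zeroLevel ρ μ₁, e p ∈ zeroLevel ρ μ₁) {f : HKQuotient ρ μ₁ → HKQuotient ρ μ₁}
    (hf : ∀ x, f (proj ρ μ₁ x) = proj ρ μ₁ (restrictLevel e he x)) (x : zeroLevel ρ μ₁)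
    (hd : MDifferentiableAt 𝓘(ℝ, EuclideanSpace ℝ (Fin k)) 𝓘(ℝ, EuclideanSpace ℝ (Fin k)) f
      (proj ρ μ₁ x)) (u : EuclideanSpace ℝ (Fin m)) :
    (mfderiv 𝓘(ℝ, EuclideanSpace ℝ (Fin k)) 𝓘(ℝ, EuclideanSpace ℝ (Fin k)) f (proj ρ μ₁ x) :
      EuclideanSpace ℝ (Fin k) →L[ℝ] EuclideanSpace ℝ (Fin k)) (dProj ρ μ₁ m k x u) =
      dProj ρ μ₁ m k (restrictLevel e he x) (dRestrict e he x u) := by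
  have hpr := h.isSubmersion.contMDiff
  have h1 := HasMFDerivAt.comp x
    (hpr (restrictLevel e he x) |>.mdifferentiableAt (by simp)).hasMFDerivAt
    (contMDiff_restrictLevel h e he x |>.mdifferentiableAt (by simp)).hasMFDerivAt
  have h2 := HasMFDerivAt.comp x hd.hasMFDerivAt
    (hpr x |>.mdifferentiableAt (by simp)).hasMFDerivAt
  have h3 := hasMFDerivAt_unique h2 (h1.congr_of_eventuallyEq (.of_forall hf))
  exact DFunLike.congr_fun h3 u

end Smooth

/-- An isometry that descends to the quotient, together with its inverse, maps horizontal vectors to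
horizontal vectors. -/
lemma dRestrict_mem_horizontal (h : IsSmoothQuotient ρ μ₁ m k) {e e' : Cot n ≃ᵢ Cot n}
    (he : ∀ p ∈ zeroLevel ρ μ₁, e p ∈ zeroLevel ρ μ₁)
    (he' : ∀ p ∈ zeroLevel ρ μ₁, e' p ∈ zeroLevel ρ μ₁) (hee' : ∀ p, e (e' p) = p)
    (he'e : ∀ p, e' (e p) = p) {x y : zeroLevel ρ μ₁} (hxy : restrictLevel e he x = y)
    (hker : ∀ a, dProj ρ μ₁ m k y a = 0 →
      dProj ρ μ₁ m k (restrictLevel e' he' y) (dRestrict e' he' y a) = 0)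
    {w : EuclideanSpace ℝ (Fin m)} (hw : w ∈ horizontal ρ μ₁ m k x) :
    dRestrict e he x w ∈ horizontal ρ μ₁ m k (restrictLevel e he x) := by
  intro a ha
  rw [hxy] at ha
  have hx : restrictLevel e' he' y = x := by
    rw [← hxy]; exact Subtype.ext (he'e x.1)
  -- The vertical vector `a` at `y` is carried by `e'` to a vertical vector at `x`, which is
  -- orthogonal to `w`; applying the isometry `e` gives back `a` and preserves the orthogonality.
  have h1 := hker a ha
  have h2 := dIncl_dRestrict h _ he' y a
  rw [hx] at h1 h2
  have h3 := hw _ h1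
  rw [h2] at h3
  have h4 : fderiv ℝ e x.1 (fderiv ℝ e' y.1 (dIncl ρ μ₁ m y a)) = dIncl ρ μ₁ m y a := by
    have hd := hasFDerivAt_isometryEquiv e x.1
    have hd' := hasFDerivAt_isometryEquiv e' y.1
    have hx' : e' y.1 = x.1 := congrArg Subtype.val hx
    rw [← hx'] at hd
    have h5 := (hd.comp y.1 hd').congr_of_eventuallyEq
      (f₁ := id) (.of_forall fun p => (hee' p).symm)
    have h6 := h5.unique (hasFDerivAt_id y.1)
    rw [hd'.fderiv, ← hx', hd.fderiv]
    exact DFunLike.congr_fun h6 _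
  rw [dIncl_dRestrict h, hxy, ← h4, flatInner_fderiv_isometryEquiv]
  exact h3

section Lie

variable [LieGroup 𝓘(ℝ, EG) ∞ G]
  {EH : Type*} [NormedAddCommGroup EH] [NormedSpace ℝ EH]
  [TopologicalSpace H] [ChartedSpace EH H]

/-- It suffices to compare horizontal lifts. The derivative of `σ t` maps them to horizontal vectors
with the same inner products, and `quotientMetric_dProj` computes the metric at both points,
whichever representatives are used. -/
lemma preservesMetric_quotientAction
    (hρ : ContMDiff (𝓘(ℝ, EG).prod 𝓘(ℝ, Aff n)) 𝓘(ℝ, Aff n) ∞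
      (fun a : G × Aff n => ρ a.1 a.2)) (hμ : IsMomentMapOne ρ μ₁)
    (h : IsSmoothQuotient ρ μ₁ m k) {σ : H →* (Cot n ≃ᵢ Cot n)}
    (hσ : ContMDiff (𝓘(ℝ, EH).prod 𝓘(ℝ, Cot n)) 𝓘(ℝ, Cot n) ∞ (fun a : H × Cot n => σ a.1 a.2))
    (hpres : ∀ (t : H), ∀ p ∈ zeroLevel ρ μ₁, σ t p ∈ zeroLevel ρ μ₁)
    (hnorm : σ.range ≤ Subgroup.normalizer (cotLift.comp ρ).range) (t : H) :
    PreservesMetric (quotientMetric h) (quotientAction σ hpres hnorm t) := by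
  intro q v w
  obtain ⟨x, rfl⟩ := proj_surjective q
  obtain ⟨⟨v, hv⟩, rfl⟩ := (bijective_horizontal h x).2 v
  obtain ⟨⟨w, hw⟩, rfl⟩ := (bijective_horizontal h x).2 w
  have hd : ∀ (t : H) (q : HKQuotient ρ μ₁), MDifferentiableAt 𝓘(ℝ, EuclideanSpace ℝ (Fin k))
      𝓘(ℝ, EuclideanSpace ℝ (Fin k)) (quotientAction σ hpres hnorm t) q := fun t q =>
    ((contMDiff_quotientAction h hσ hpres hnorm).comp
      (contMDiff_const (c := t) |>.prodMk contMDiff_id) q).mdifferentiableAt (by simp)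
  have hmf := fun (t : H) (x : zeroLevel ρ μ₁) => mfderiv_quotient_dProj h (σ t) (hpres t)
    (quotientAction_proj σ hpres hnorm t) x (hd t _)
  have hhor : ∀ u ∈ horizontal ρ μ₁ m k x, dRestrict (σ t) (hpres t) x u ∈
      horizontal ρ μ₁ m k (restrictLevel (σ t) (hpres t) x) := fun u hu =>
    dRestrict_mem_horizontal h (e' := σ t⁻¹) (hpres t) (hpres t⁻¹)
      (fun p => by simp [← IsometryEquiv.mul_apply])
      (fun p => by simp [← IsometryEquiv.mul_apply]) rfl
      -- Vertical vectors stay vertical under `σ t⁻¹` because it descends: projecting the image of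
      -- `a` amounts to applying the derivative of the induced map to the projection of `a`, which
      -- is zero.
      (fun a ha => (hmf t⁻¹ _ a).symm.trans ((congrArg _ ha).trans (map_zero _))) hu
  refine Eq.trans ?_ ((quotientMetric_dProj hρ hμ h
    (restrictLevel (σ t) (hpres t) x) _ _ (hhor v hv) (hhor w hw)).trans ?_)
  · exact congrArg₂ (fun a b => (quotientMetric h).inner
      (proj ρ μ₁ (restrictLevel (σ t) (hpres t) x)) a b) (hmf t x v) (hmf t x w)
  · rw [dIncl_dRestrict h, dIncl_dRestrict h, flatInner_fderiv_isometryEquiv]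
    exact (quotientMetric_dProj hρ hμ h x _ _ hv hw).symm

/-- The projection does not increase the length of tangent vectors. -/
lemma quotientMetric_dProj_le
    (hρ : ContMDiff (𝓘(ℝ, EG).prod 𝓘(ℝ, Aff n)) 𝓘(ℝ, Aff n) ∞
      (fun a : G × Aff n => ρ a.1 a.2)) (hμ : IsMomentMapOne ρ μ₁)
    (h : IsSmoothQuotient ρ μ₁ m k) (x : zeroLevel ρ μ₁) (u : EuclideanSpace ℝ (Fin m)) :
    (quotientMetric h).inner (proj ρ μ₁ x) (dProj ρ μ₁ m k x u) (dProj ρ μ₁ m k x u) ≤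
      ‖dIncl ρ μ₁ m x u‖ ^ 2 := by
  obtain ⟨w, hw, hwu⟩ := exists_horizontal (k := k) x u
  have hv : dProj ρ μ₁ m k x (u - w) = 0 := by rw [map_sub, hwu, sub_self]
  have h1 := hw _ hv
  -- Pythagoras for the horizontal part `w` and the vertical part `u - w`; the quotient metric sees
  -- only `w`.
  have h2 : flatInner (dIncl ρ μ₁ m x u) (dIncl ρ μ₁ m x u) =
      flatInner (dIncl ρ μ₁ m x w) (dIncl ρ μ₁ m x w) +
        flatInner (dIncl ρ μ₁ m x (u - w)) (dIncl ρ μ₁ m x (u - w)) := by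
    have h3 : dIncl ρ μ₁ m x u = dIncl ρ μ₁ m x w + dIncl ρ μ₁ m x (u - w) := by
      rw [← map_add, add_sub_cancel]
    rw [h3, flatInner_add_left, re_inner_comm _ (_ + _), flatInner_add_left,
      re_inner_comm _ (_ + _), flatInner_add_left,
      re_inner_comm (dIncl ρ μ₁ m x (u - w)) (dIncl ρ μ₁ m x w), h1]
    ring
  rw [← hwu]
  refine (quotientMetric_dProj hρ hμ h x w w hw hw).trans_le ?_
  rw [← flatInner_self, h2, flatInner_self (dIncl ρ μ₁ m x (u - w))]
  nlinarith [sq_nonneg ‖dIncl ρ μ₁ m x (u - w)‖]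

end Lie

end Descent

end HKQ

namespace HKQ

/-! ### Euclidean distance between orbits versus Riemannian distance in the quotient -/

section Growth

open Manifold

/-- If the increments of a real function are bounded by those of a curve, so is its derivative. -/
lemma abs_deriv_le_of_abs_sub_le {V : Type*} [NormedAddCommGroup V] [NormedSpace ℝ V]
    {g : ℝ → ℝ} {c : ℝ → V} {t : ℝ} {c' : V} (hc : HasDerivAt c c' t)
    (h : ∀ᶠ s in nhds t, |g s - g t| ≤ dist (c s) (c t)) : |deriv g t| ≤ ‖c'‖ := by
  by_cases hg : DifferentiableAt ℝ g t
  · have h1 := (hasDerivAt_iff_tendsto_slope.1 hg.hasDerivAt).norm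
    have h2 := (hasDerivAt_iff_tendsto_slope.1 hc).norm
    refine le_of_tendsto_of_tendsto h1 h2 ?_
    filter_upwards [h.filter_mono nhdsWithin_le_nhds] with s hs
    rw [slope_def_module, slope_def_module, norm_smul, norm_smul]
    rw [dist_eq_norm] at hs
    exact mul_le_mul_of_nonneg_left hs (norm_nonneg _)
  -- Without differentiability `deriv` has the default value `0`, so the bound still holds.
  · rw [deriv_zero_of_not_differentiableAt hg, abs_zero]
    exact norm_nonneg _

lemma hasMFDerivAt_toSpanSingleton {E M : Type*} [NormedAddCommGroup E] [NormedSpace ℝ E]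
    [TopologicalSpace M] [ChartedSpace E M] {γ : ℝ → M} {t : ℝ}
    (hγ : MDifferentiableAt 𝓘(ℝ, ℝ) 𝓘(ℝ, E) γ t) :
    HasMFDerivAt 𝓘(ℝ, ℝ) 𝓘(ℝ, E) γ t (ContinuousLinearMap.toSpanSingleton ℝ
      ((mfderiv 𝓘(ℝ, ℝ) 𝓘(ℝ, E) γ t : ℝ →L[ℝ] E) 1) : ℝ →L[ℝ] E) := by
  have h : ∀ L : ℝ →L[ℝ] E, ContinuousLinearMap.toSpanSingleton ℝ (L 1) = L := fun L => by
    ext; simp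
  exact (h _).symm ▸ hγ.hasMFDerivAt

/-- The fundamental theorem of calculus for a Lipschitz, hence absolutely continuous, function. It
is needed in this generality because the distance to an orbit need not be differentiable everywhere
along a curve. -/
lemma ofReal_sub_le_lintegral_abs_deriv {f : ℝ → ℝ} (hf : LocallyLipschitz f) :
    ENNReal.ofReal (f 1 - f 0) ≤ ∫⁻ t in Set.Icc 0 1, ENNReal.ofReal |deriv f t| := by
  obtain ⟨K, hK⟩ := hf.locallyLipschitzOn (s := Set.uIcc 0 1)
    |>.exists_lipschitzOnWith_of_compact isCompact_uIcc
  have hint := hK.absolutelyContinuousOnInterval.integral_deriv_eq_sub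
  rw [intervalIntegral.integral_of_le zero_le_one,
    ← MeasureTheory.integral_Icc_eq_integral_Ioc] at hint
  rw [← hint]
  refine (ENNReal.ofReal_le_ofReal (le_abs_self _)).trans ?_
  rw [← Real.norm_eq_abs, ofReal_norm]
  refine (MeasureTheory.enorm_integral_le_lintegral_enorm _).trans_eq ?_
  simp only [← ofReal_norm, Real.norm_eq_abs]

variable {n : ℕ} {EG : Type*} [NormedAddCommGroup EG] [NormedSpace ℝ EG]
  {G : Type*} [TopologicalSpace G] [ChartedSpace EG G] [Group G]
  {ρ : G →* (Aff n ≃ᵃⁱ[ℂ] Aff n)}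
  {μ₁ : Cot n → Module.Dual ℝ (GroupLieAlgebra 𝓘(ℝ, EG) G)}

/-- The distance in `T*A` from a point to a `G`-orbit in the level set. -/
def orbitDist (p : Cot n) (q : HKQuotient ρ μ₁) : ℝ :=
  Metric.infDist p (Subtype.val '' {y : zeroLevel ρ μ₁ | proj ρ μ₁ y = q})

lemma nonempty_orbit (q : HKQuotient ρ μ₁) :
    (Subtype.val '' {y : zeroLevel ρ μ₁ | proj ρ μ₁ y = q}).Nonempty := by
  obtain ⟨y, hy⟩ := proj_surjective q
  exact ⟨y.1, y, hy, rfl⟩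

/-- Orbits are not known to be closed, so a nearest point may not exist. The slack `1` is absorbed
into the additive constant of the growth estimate. -/
lemma exists_dist_lt_orbitDist_add_one (p : Cot n) (q : HKQuotient ρ μ₁) :
    ∃ y : zeroLevel ρ μ₁, proj ρ μ₁ y = q ∧ dist p y.1 < orbitDist p q + 1 := by
  obtain ⟨_, ⟨y, hy, rfl⟩, h⟩ := (Metric.infDist_lt_iff (nonempty_orbit q)).1
    (lt_add_one (orbitDist p q))
  exact ⟨y, hy, h⟩

lemma orbitDist_self (y : zeroLevel ρ μ₁) : orbitDist y.1 (proj ρ μ₁ y) = 0 :=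
  Metric.infDist_zero_of_mem ⟨y, rfl, rfl⟩

/-- If `g` moves `y'` to a point `z` of its orbit, it moves `y` to a point of the orbit of `y` at
the same distance from `z`. Hence arbitrary representatives `y`, `y'` bound the increment of
`orbitDist p`. -/
lemma orbitDist_le_add (hmem : ∀ (g : G), ∀ p ∈ zeroLevel ρ μ₁, cotLift (ρ g) p ∈ zeroLevel ρ μ₁)
    (p : Cot n) (y y' : zeroLevel ρ μ₁) :
    orbitDist p (proj ρ μ₁ y) ≤ orbitDist p (proj ρ μ₁ y') + dist y.1 y'.1 := by
  rw [← sub_le_iff_le_add]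
  refine (Metric.le_infDist (nonempty_orbit _)).2 ?_
  rintro _ ⟨z, hz, rfl⟩
  obtain ⟨g, hg⟩ := exists_cotLift_of_proj_eq (Eq.symm hz)
  have h1 : orbitDist p (proj ρ μ₁ y) ≤ dist p (cotLift (ρ g) y.1) :=
    Metric.infDist_le_dist_of_mem
      ⟨⟨_, hmem g _ y.2⟩, (proj_cotLift (x := y) (g := g) rfl).symm, rfl⟩
  have h2 : dist (cotLift (ρ g) y.1) z.1 = dist y.1 y'.1 := by
    rw [← hg]; exact (cotLift (ρ g)).isometry.dist_eq _ _
  have h3 := dist_triangle p z.1 (cotLift (ρ g) y.1)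
  rw [dist_comm z.1, h2] at h3
  linarith

lemma abs_orbitDist_sub_le
    (hmem : ∀ (g : G), ∀ p ∈ zeroLevel ρ μ₁, cotLift (ρ g) p ∈ zeroLevel ρ μ₁)
    (p : Cot n) (y y' : zeroLevel ρ μ₁) :
    |orbitDist p (proj ρ μ₁ y) - orbitDist p (proj ρ μ₁ y')| ≤ dist y.1 y'.1 := by
  have h1 := orbitDist_le_add hmem p y y'
  have h2 := orbitDist_le_add hmem p y' y
  rw [dist_comm] at h2
  rw [abs_le]; constructor <;> linarith

variable {m k : ℕ}
  [ChartedSpace (EuclideanSpace ℝ (Fin m)) (zeroLevel ρ μ₁)]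
  [ChartedSpace (EuclideanSpace ℝ (Fin k)) (HKQuotient ρ μ₁)]

lemma enorm_eq_quotientMetric (h : IsSmoothQuotient ρ μ₁ m k) (q : HKQuotient ρ μ₁)
    (v : TangentSpace 𝓘(ℝ, EuclideanSpace ℝ (Fin k)) q) :
    letI : Bundle.RiemannianBundle
      (fun x : HKQuotient ρ μ₁ => TangentSpace 𝓘(ℝ, EuclideanSpace ℝ (Fin k)) x) :=
      ⟨quotientMetric h⟩
    ‖v‖ₑ = ENNReal.ofReal (√((quotientMetric h).inner q v v)) := by
  let _ : Bundle.RiemannianBundle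
    (fun x : HKQuotient ρ μ₁ => TangentSpace 𝓘(ℝ, EuclideanSpace ℝ (Fin k)) x) :=
    ⟨quotientMetric h⟩
  rw [← ofReal_norm, norm_eq_sqrt_real_inner]
  rfl

/-- A smooth local section lifts `γ` to a C¹ curve in `T*A`, which is locally Lipschitz and whose
increments dominate those of `orbitDist p` along `γ`. -/
lemma locallyLipschitz_orbitDist_comp (h : IsSmoothQuotient ρ μ₁ m k)
    (hmem : ∀ (g : G), ∀ p ∈ zeroLevel ρ μ₁, cotLift (ρ g) p ∈ zeroLevel ρ μ₁)
    (p : Cot n) {γ : ℝ → HKQuotient ρ μ₁}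
    (hγ : ContMDiff 𝓘(ℝ, ℝ) 𝓘(ℝ, EuclideanSpace ℝ (Fin k)) 1 γ) :
    LocallyLipschitz (fun t => orbitDist p (γ t)) := by
  intro t
  obtain ⟨x, hx⟩ := proj_surjective (γ t)
  obtain ⟨s, hsx, hs, hps⟩ := exists_contMDiffAt_section (h.isSubmersion.isSubmersionAt x)
  rw [hx] at hs hps
  have h1 : ContMDiffAt 𝓘(ℝ, ℝ) 𝓘(ℝ, Cot n) 1 (fun r => (s (γ r)).1) t :=
    ((h.isSmoothEmbedding.contMDiff.of_le (by simp)).contMDiffAt).comp t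
      ((hs.of_le (by simp)).comp t hγ.contMDiffAt)
  obtain ⟨K, U, hU, hK⟩ := h1.contDiffAt.exists_lipschitzOnWith
  refine ⟨K, _, Filter.inter_mem hU (hγ.continuous.continuousAt.eventually hps), ?_⟩
  refine LipschitzOnWith.of_dist_le_mul fun a ha b hb => ?_
  have h2 := abs_orbitDist_sub_le hmem p (s (γ a)) (s (γ b))
  rw [show proj ρ μ₁ (s (γ a)) = γ a from ha.2, show proj ρ μ₁ (s (γ b)) = γ b from hb.2] at h2
  exact h2.trans (hK.dist_le_mul a ha.1 b hb.1)

variable [LieGroup 𝓘(ℝ, EG) ∞ G]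

/-- The curve is lifted locally so that its velocity at `t` is the horizontal lift of `v`, whose
Euclidean length is the quotient norm of `v`. The lift need not be horizontal at any other time. -/
lemma abs_deriv_orbitDist_comp_le
    (hρ : ContMDiff (𝓘(ℝ, EG).prod 𝓘(ℝ, Aff n)) 𝓘(ℝ, Aff n) ∞
      (fun a : G × Aff n => ρ a.1 a.2)) (hμ : IsMomentMapOne ρ μ₁)
    (h : IsSmoothQuotient ρ μ₁ m k) (p : Cot n) {γ : ℝ → HKQuotient ρ μ₁} {t : ℝ}
    {v : EuclideanSpace ℝ (Fin k)}
    (hv : HasMFDerivAt 𝓘(ℝ, ℝ) 𝓘(ℝ, EuclideanSpace ℝ (Fin k)) γ t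
      (ContinuousLinearMap.toSpanSingleton ℝ v : ℝ →L[ℝ] EuclideanSpace ℝ (Fin k))) :
    |deriv (fun s => orbitDist p (γ s)) t| ≤ √((quotientMetric h).inner (γ t) v v) := by
  obtain ⟨x, hx⟩ := proj_surjective (γ t)
  obtain ⟨⟨u, hu⟩, huv⟩ := (bijective_horizontal h x).2 v
  obtain ⟨c, hct, hc, hpc⟩ := exists_curve_lift (h.isSubmersion.isSubmersionAt x) hx.symm hv huv
  have h1 := hasDerivAt_of_hasMFDerivAt (HasMFDerivAt.comp_curve hct
    (h.isSmoothEmbedding.contMDiff x |>.mdifferentiableAt (by simp)).hasMFDerivAt hc)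
  have h2 : ∀ᶠ s in nhds t, |orbitDist p (γ s) - orbitDist p (γ t)| ≤ dist (c s).1 (c t).1 := by
    filter_upwards [hpc] with s hs
    rw [← hs, ← hx, hct]
    exact abs_orbitDist_sub_le (cotLift_mem_zeroLevel hρ hμ) p _ _
  refine (abs_deriv_le_of_abs_sub_le h1 h2).trans ?_
  refine Real.le_sqrt_of_sq_le ?_
  have h3 := quotientMetric_dProj hρ hμ h x u u hu hu
  rw [flatInner_self] at h3
  rw [← hx, ← huv]
  exact h3.ge

/-- The distance in `T*A` between two orbits is at most the Riemannian distance in the quotient. -/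
lemma orbitDist_le_riemannianEDist
    (hρ : ContMDiff (𝓘(ℝ, EG).prod 𝓘(ℝ, Aff n)) 𝓘(ℝ, Aff n) ∞
      (fun a : G × Aff n => ρ a.1 a.2)) (hμ : IsMomentMapOne ρ μ₁)
    (h : IsSmoothQuotient ρ μ₁ m k) (x : zeroLevel ρ μ₁) (q : HKQuotient ρ μ₁) :
    letI : Bundle.RiemannianBundle
      (fun x : HKQuotient ρ μ₁ => TangentSpace 𝓘(ℝ, EuclideanSpace ℝ (Fin k)) x) :=
      ⟨quotientMetric h⟩
    ENNReal.ofReal (orbitDist x.1 q) ≤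
      riemannianEDist 𝓘(ℝ, EuclideanSpace ℝ (Fin k)) (proj ρ μ₁ x) q := by
  let _ : Bundle.RiemannianBundle
    (fun x : HKQuotient ρ μ₁ => TangentSpace 𝓘(ℝ, EuclideanSpace ℝ (Fin k)) x) :=
    ⟨quotientMetric h⟩
  -- If the Riemannian distance is infinite there is no such `r`, and nothing to prove.
  refine le_of_forall_gt fun r hr => ?_
  -- The path is C¹ on all of `ℝ`, so the two-sided derivative bound also applies at the endpoints.
  obtain ⟨γ, hγ0, hγ1, hγ, hlen, -, -⟩ :=
    exists_lt_locally_constant_of_riemannianEDist_lt hr zero_lt_one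
  refine lt_of_le_of_lt ?_ hlen
  have h0 := ofReal_sub_le_lintegral_abs_deriv
    (locallyLipschitz_orbitDist_comp h (cotLift_mem_zeroLevel hρ hμ) x.1 hγ)
  rw [hγ0, hγ1, orbitDist_self, sub_zero] at h0
  rw [pathELength_eq_lintegral_mfderiv_Icc]
  refine h0.trans (MeasureTheory.lintegral_mono fun t => ?_)
  have h1 : HasMFDerivAt 𝓘(ℝ, ℝ) 𝓘(ℝ, EuclideanSpace ℝ (Fin k)) γ t
      (ContinuousLinearMap.toSpanSingleton ℝ
        (mfderiv 𝓘(ℝ, ℝ) 𝓘(ℝ, EuclideanSpace ℝ (Fin k)) γ t 1 : EuclideanSpace ℝ (Fin k)) :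
        ℝ →L[ℝ] EuclideanSpace ℝ (Fin k)) :=
    hasMFDerivAt_toSpanSingleton (hγ t |>.mdifferentiableAt (by simp))
  exact (ENNReal.ofReal_le_ofReal (abs_deriv_orbitDist_comp_le hρ hμ h x.1 h1)).trans_eq
    (enorm_eq_quotientMetric h _ _).symm

end Growth

/-! ### Linear growth of the Killing fields -/

section Killing

open Manifold

variable {n : ℕ} {EH : Type*} [NormedAddCommGroup EH] [NormedSpace ℝ EH]
  {H : Type*} [TopologicalSpace H] [ChartedSpace EH H] [Group H]

/-- The vector fields generated by a group of isometries of `T*A` have linear growth. -/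
lemma exists_norm_fundamentalField_le {σ : H →* (Cot n ≃ᵢ Cot n)}
    (hσ : ContMDiff (𝓘(ℝ, EH).prod 𝓘(ℝ, Cot n)) 𝓘(ℝ, Cot n) ∞ (fun a : H × Cot n => σ a.1 a.2))
    (ξ : GroupLieAlgebra 𝓘(ℝ, EH) H) (p : Cot n) :
    ∃ C B : ℝ≥0, ∀ q v : Cot n, v = fundamentalField (E := Cot n) (fun t x => σ t x) ξ q →
      ‖v‖ ≤ C * dist p q + B := by
  let Y : Cot n → Cot n := fun q => fundamentalField (E := Cot n) (fun t x => σ t x) ξ q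
  have hd : ∀ q, MDifferentiableAt 𝓘(ℝ, EH) 𝓘(ℝ, Cot n) (fun t : H => σ t q) 1 := fun q =>
    (hσ.comp (contMDiff_id.prodMk contMDiff_const) 1).mdifferentiableAt (by simp)
  -- A surjective isometry of a real normed space is affine (Mazur–Ulam), so `σ t (p + v) - σ t p`
  -- is linear in `v` for each `t`. Differentiating in `t` at the identity preserves the linear
  -- relations.
  have hlin : ∀ (c d : ℝ) (v w : Cot n),
      Y (p + (c • v + d • w)) - Y p = c • (Y (p + v) - Y p) + d • (Y (p + w) - Y p) := by
    intro c d v w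
    have hσt : ∀ (t : H) (v : Cot n), σ t (p + v) - σ t p =
        (σ t).toRealAffineIsometryEquiv.linearIsometryEquiv v := fun t v => by
      have := (σ t).toRealAffineIsometryEquiv.map_vadd p v
      rw [vadd_eq_add, vadd_eq_add, add_comm] at this
      exact sub_eq_of_eq_add this
    have h1 := (hd (p + (c • v + d • w))).hasMFDerivAt.sub (hd p).hasMFDerivAt
    have h2 := ((hd (p + v)).hasMFDerivAt.sub (hd p).hasMFDerivAt).const_smul c |>.add
      (((hd (p + w)).hasMFDerivAt.sub (hd p).hasMFDerivAt).const_smul d)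
    have h3 := hasMFDerivAt_unique h1 (h2.congr_of_eventuallyEq (.of_forall fun t => ?_))
    · exact DFunLike.congr_fun h3 ξ
    · change σ t (p + (c • v + d • w)) - σ t p =
        c • (σ t (p + v) - σ t p) + d • (σ t (p + w) - σ t p)
      rw [hσt, hσt, hσt, map_add, map_smul, map_smul]
  let A : Cot n →ₗ[ℝ] Cot n :=
    { toFun := fun v => Y (p + v) - Y p
      map_add' := fun v w => by simpa using hlin 1 1 v w
      map_smul' := fun c v => by simpa using hlin c 0 v 0 }
  -- The slope is the operator norm of the linear part of the affine field `Y`, finite because `T*A`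
  -- has finite dimension; the constant is its norm at `p`.
  refine ⟨‖LinearMap.toContinuousLinearMap A‖₊, ‖Y p‖₊, ?_⟩
  rintro q _ rfl
  have h1 : Y q = LinearMap.toContinuousLinearMap A (q - p) + Y p := by
    change _ = Y (p + (q - p)) - Y p + Y p
    simp
  change ‖Y q‖ ≤ _ + ‖Y p‖
  rw [h1, dist_comm, dist_eq_norm]
  exact (norm_add_le _ _).trans
    (add_le_add_left ((LinearMap.toContinuousLinearMap A).le_opNorm _) _)

variable {EG : Type*} [NormedAddCommGroup EG] [NormedSpace ℝ EG]
  {G : Type*} [TopologicalSpace G] [ChartedSpace EG G] [Group G]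
  {ρ : G →* (Aff n ≃ᵃⁱ[ℂ] Aff n)}
  {μ₁ : Cot n → Module.Dual ℝ (GroupLieAlgebra 𝓘(ℝ, EG) G)} {m k : ℕ}
  [ChartedSpace (EuclideanSpace ℝ (Fin m)) (zeroLevel ρ μ₁)]
  [ChartedSpace (EuclideanSpace ℝ (Fin k)) (HKQuotient ρ μ₁)]

/-- The vector field generated by the induced action is the projection of a vector field on the
level set, the restriction of the vector field generated on `T*A`. -/
lemma exists_dProj_eq_fundamentalField (h : IsSmoothQuotient ρ μ₁ m k)
    {σ : H →* (Cot n ≃ᵢ Cot n)}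
    (hσ : ContMDiff (𝓘(ℝ, EH).prod 𝓘(ℝ, Cot n)) 𝓘(ℝ, Cot n) ∞ (fun a : H × Cot n => σ a.1 a.2))
    (hpres : ∀ (t : H), ∀ p ∈ zeroLevel ρ μ₁, σ t p ∈ zeroLevel ρ μ₁)
    (hnorm : σ.range ≤ Subgroup.normalizer (cotLift.comp ρ).range)
    (ξ : GroupLieAlgebra 𝓘(ℝ, EH) H) (x : zeroLevel ρ μ₁) :
    ∃ u, dIncl ρ μ₁ m x u = fundamentalField (E := Cot n) (fun t x => σ t x) ξ x.1 ∧
      dProj ρ μ₁ m k x u = fundamentalField (E := EuclideanSpace ℝ (Fin k))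
        (fun t q => quotientAction σ hpres hnorm t q) ξ (proj ρ μ₁ x) := by
  -- The orbit map of `x` inside `μ⁻¹(0)`. Composing it with the inclusion and with the projection
  -- gives the orbit maps in `T*A` and in the quotient, so `D ξ` is the required vector.
  let c : H → zeroLevel ρ μ₁ := fun t => restrictLevel (σ t) (hpres t) x
  have hc1 : c 1 = x := Subtype.ext (by simp [c, restrictLevel])
  have hc : ContMDiff 𝓘(ℝ, EH) 𝓘(ℝ, EuclideanSpace ℝ (Fin m)) ∞ c :=
    (contMDiff_restrictLevel_action h hσ hpres).comp (contMDiff_id.prodMk contMDiff_const)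
  let D : EH →L[ℝ] EuclideanSpace ℝ (Fin m) :=
    mfderiv 𝓘(ℝ, EH) 𝓘(ℝ, EuclideanSpace ℝ (Fin m)) c 1
  have hD : HasMFDerivAt 𝓘(ℝ, EH) 𝓘(ℝ, EuclideanSpace ℝ (Fin m)) c 1 D :=
    (hc 1 |>.mdifferentiableAt (by simp)).hasMFDerivAt
  have h1 : HasMFDerivAt 𝓘(ℝ, EH) 𝓘(ℝ, Cot n) (Subtype.val ∘ c) 1 ((dIncl ρ μ₁ m x).comp D) :=
    HasMFDerivAt.comp 1 (by
      rw [hc1]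
      exact (h.isSmoothEmbedding.contMDiff x |>.mdifferentiableAt (by simp)).hasMFDerivAt) hD
  have h2 : HasMFDerivAt 𝓘(ℝ, EH) 𝓘(ℝ, EuclideanSpace ℝ (Fin k)) (proj ρ μ₁ ∘ c) 1
      ((dProj ρ μ₁ m k x).comp D) :=
    HasMFDerivAt.comp 1 (by
      rw [hc1]
      exact (h.isSubmersion.contMDiff x |>.mdifferentiableAt (by simp)).hasMFDerivAt) hD
  exact ⟨D ξ, (DFunLike.congr_fun h1.mfderiv ξ).symm, (DFunLike.congr_fun h2.mfderiv ξ).symm⟩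

variable [LieGroup 𝓘(ℝ, EG) ∞ G]

lemma hasLinearGrowth_quotientAction
    (hρ : ContMDiff (𝓘(ℝ, EG).prod 𝓘(ℝ, Aff n)) 𝓘(ℝ, Aff n) ∞
      (fun a : G × Aff n => ρ a.1 a.2)) (hμ : IsMomentMapOne ρ μ₁)
    (h : IsSmoothQuotient ρ μ₁ m k) {σ : H →* (Cot n ≃ᵢ Cot n)}
    (hσ : ContMDiff (𝓘(ℝ, EH).prod 𝓘(ℝ, Cot n)) 𝓘(ℝ, Cot n) ∞ (fun a : H × Cot n => σ a.1 a.2))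
    (hpres : ∀ (t : H), ∀ p ∈ zeroLevel ρ μ₁, σ t p ∈ zeroLevel ρ μ₁)
    (hnorm : σ.range ≤ Subgroup.normalizer (cotLift.comp ρ).range)
    (ξ : GroupLieAlgebra 𝓘(ℝ, EH) H) :
    HasLinearGrowth (quotientMetric h) (fundamentalField (E := EuclideanSpace ℝ (Fin k))
      (fun t q => quotientAction σ hpres hnorm t q) ξ) := by
  let _ : Bundle.RiemannianBundle
    (fun x : HKQuotient ρ μ₁ => TangentSpace 𝓘(ℝ, EuclideanSpace ℝ (Fin k)) x) :=
    ⟨quotientMetric h⟩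
  intro q₀
  obtain ⟨x₀, rfl⟩ := proj_surjective q₀
  obtain ⟨C, B, hC⟩ := exists_norm_fundamentalField_le hσ ξ x₀.1
  -- The extra `C` is the slope times the slack `1` in the choice of an almost nearest point `y`.
  refine ⟨C, C + B, fun q => ?_⟩
  obtain ⟨y, rfl, hy⟩ := exists_dist_lt_orbitDist_add_one x₀.1 q
  obtain ⟨u, hu, hu'⟩ := exists_dProj_eq_fundamentalField h hσ hpres hnorm ξ y
  have h0 : 0 ≤ orbitDist x₀.1 (proj ρ μ₁ y) := Metric.infDist_nonneg
  have h1 : √((quotientMetric h).inner (proj ρ μ₁ y) (dProj ρ μ₁ m k y u) (dProj ρ μ₁ m k y u)) ≤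
      C * orbitDist x₀.1 (proj ρ μ₁ y) + (C + B) := by
    refine (Real.sqrt_le_sqrt (quotientMetric_dProj_le hρ hμ h y u)).trans ?_
    rw [Real.sqrt_sq (norm_nonneg _)]
    refine (hC y.1 _ hu).trans ?_
    have := mul_le_mul_of_nonneg_left hy.le C.2
    change (C : ℝ) * _ ≤ C * _ at this
    linarith
  rw [← hu']
  refine (enorm_eq_quotientMetric h _ _).trans_le ((ENNReal.ofReal_le_ofReal h1).trans ?_)
  rw [ENNReal.ofReal_add (by positivity) (by positivity), ENNReal.ofReal_mul C.coe_nonneg]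
  refine add_le_add (mul_le_mul' (by simp)
    (orbitDist_le_riemannianEDist hρ hμ h x₀ (proj ρ μ₁ y))) ?_
  rw [← NNReal.coe_add, ENNReal.ofReal_coe_nnreal, ENNReal.coe_add]

end Killing

end HKQ

theorem proposition5 (n m k : ℕ)
    -- `G`: a Lie group acting smoothly on the affine space `A` by unitary isometries
    {EG : Type*} [NormedAddCommGroup EG] [NormedSpace ℝ EG] [FiniteDimensional ℝ EG]
    {G : Type*} [TopologicalSpace G] [ChartedSpace EG G] [Group G] [LieGroup 𝓘(ℝ, EG) ∞ G]
    (ρ : G →* (HKQ.Aff n ≃ᵃⁱ[ℂ] HKQ.Aff n))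
    (hρ : ContMDiff (𝓘(ℝ, EG).prod 𝓘(ℝ, HKQ.Aff n)) 𝓘(ℝ, HKQ.Aff n) ∞
      (fun a : G × HKQ.Aff n => ρ a.1 a.2))
    -- an arbitrary choice of the real moment map
    (μ₁ : HKQ.Cot n → Module.Dual ℝ (GroupLieAlgebra 𝓘(ℝ, EG) G))
    (hμ : HKQ.IsMomentMapOne ρ μ₁)
    -- `μ⁻¹(0)` and the quotient are smooth
    [ChartedSpace (EuclideanSpace ℝ (Fin m)) (HKQ.zeroLevel ρ μ₁)]
    [ChartedSpace (EuclideanSpace ℝ (Fin k)) (HKQ.HKQuotient ρ μ₁)]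
    (hQ : HKQ.IsSmoothQuotient ρ μ₁ m k)
    -- `H`: a Lie group acting smoothly on `T*A` by isometries
    {EH : Type*} [NormedAddCommGroup EH] [NormedSpace ℝ EH] [FiniteDimensional ℝ EH]
    {H : Type*} [TopologicalSpace H] [ChartedSpace EH H] [Group H] [LieGroup 𝓘(ℝ, EH) ∞ H]
    (σ : H →* (HKQ.Cot n ≃ᵢ HKQ.Cot n))
    (hσ : ContMDiff (𝓘(ℝ, EH).prod 𝓘(ℝ, HKQ.Cot n)) 𝓘(ℝ, HKQ.Cot n) ∞
      (fun a : H × HKQ.Cot n => σ a.1 a.2))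
    -- `H` preserves `μ⁻¹(0)` and normalizes `G`
    (hpres : ∀ (t : H), ∀ p ∈ HKQ.zeroLevel ρ μ₁, σ t p ∈ HKQ.zeroLevel ρ μ₁)
    (hnorm : σ.range ≤ Subgroup.normalizer (HKQ.cotLift.comp ρ).range) :
    ∃ τ : H →* Equiv.Perm (HKQ.HKQuotient ρ μ₁),
      -- `τ` is the action induced on the quotient
      (∀ (t : H) (x : HKQ.zeroLevel ρ μ₁),
        τ t (HKQ.proj ρ μ₁ x) = HKQ.proj ρ μ₁ ⟨σ t x, hpres t x x.2⟩) ∧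
      -- it is smooth and isometric for the quotient metric
      ContMDiff (𝓘(ℝ, EH).prod 𝓘(ℝ, EuclideanSpace ℝ (Fin k)))
        𝓘(ℝ, EuclideanSpace ℝ (Fin k)) ∞
        (fun a : H × HKQ.HKQuotient ρ μ₁ => τ a.1 a.2) ∧
      (∀ t : H, PreservesMetric (HKQ.quotientMetric hQ) (τ t)) ∧
      -- its Killing vector fields have linear growth
      ∀ ξ : GroupLieAlgebra 𝓘(ℝ, EH) H,
        HasLinearGrowth (HKQ.quotientMetric hQ)
          (fundamentalField (E := EuclideanSpace ℝ (Fin k)) (fun t q => τ t q) ξ) := by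
  exact ⟨HKQ.quotientAction σ hpres hnorm,
    fun t x => HKQ.quotientAction_proj σ hpres hnorm t x,
    HKQ.contMDiff_quotientAction hQ hσ hpres hnorm,
    fun t => HKQ.preservesMetric_quotientAction hρ hμ hQ hσ hpres hnorm t,
    fun ξ => HKQ.hasLinearGrowth_quotientAction hρ hμ hQ hσ hpres hnorm ξ⟩
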